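/- Let $\alpha\in(0,1)$ and let $p_1\ge p_2\ge\cdots$ be real numbers with $\sum_{\ell\ge1}p_\ell=1$ and $p_\ell\sim \mathsf C_0\,\ell^{-1/\alpha}$ as $\ell\to\infty$ for some constant $\mathsf C_0>0$. Put $v(x)=\#\{\ell\ge 1: 1/p_\ell\le x\}$ and $\sigma_n=v(n)^{1/2}$. Let $N_\ell=(N_\ell(t))_{t\ge0}$, $\ell\ge1$, be independent Poisson processes, $N_\ell$ with rate $p_\ell$, and let $\widetilde D_{t,j}=\sum_{\ell\ge1}\mathbf 1_{\{N_\ell(t)=j\}}$ for $t\ge 0$, $j\ge1$. Let $(a_j)_{j\ge0}$ be real numbers with $a_0=0$ and $|a_j|\le Cj^\beta$ for all $j\ge1$, for some $\beta\in[0,\alpha/2)$ and some constant $C$, and set \[ \widetilde W_n(t)=\sum_{j=1}^\infty a_j\bigl(\widetilde D_{nt,j}-\mathbb E\widetilde D_{nt,j}\bigr)=\sum_{\ell=1}^\infty\bigl(a_{N_\ell(nt)}-\mathbb E a_{N_\ell(nt)}\bigr). \] Let $N'=(N'(t))_{t\ge0}$ be a standard (rate one) Poisson process on a probability space $(\Omega',\mathbb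 P')$ with expectation $\mathbb E'$, let $\mathcal M_\alpha$ be a centered Gaussian random measure on $(0,\infty)\times\Omega'$ with control measure $\mu(dr,d\omega')=\alpha r^{-\alpha-1}\,dr\,\mathbb P'(d\omega')$ (that is, the variables $\mathcal M_\alpha(A)$, $\mu(A)<\infty$, are jointly Gaussian and centered with $\mathrm{Cov}(\mathcal M_\alpha(A),\mathcal M_\alpha(B))=\mu(A\cap B)$), and define the stochastic ($L^2$) integrals \[ \mathcal Z_\alpha(t)=\int_{(0,\infty)\times\Omega'}\bigl(a_{N'(rt)}-\mathbb E' a_{N'(rt)}\bigr)\,\mathcal M_\alpha(dr,d\omega'),\qquad t\ge0. \] Then, for every $n$ and every $t\ge0$, both series for $\widetilde W_n(t)$ converge almost surely and agree almost surely; the integrand of $\mathcal Z_\alpha(t)$ belongs to $L^2(\mu)$, so that $\mathcal Z_\alpha(t)$ is well defined, for every $t\ge 0$; and the finite-dimensional distributions of $(\widetilde W_n(t)/\sigma_n)_{t\in[0,1]}$ converge to those of $(\mathcal Z_\alpha(t))_{t\in[0,1]}$ as $n\to\infty$: for all $d$ and $t_1,\dots,t_d\in[0,1]$, \[ \Bigl(\frac{\widetilde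 W_n(t_1)}{\sigma_n},\dots,\frac{\widetilde W_n(t_d)}{\sigma_n}\Bigr)\ \Longrightarrow\ \bigl(\mathcal Z_\alpha(t_1),\dots,\mathcal Z_\alpha(t_d)\bigr)\quad\text{in distribution.} \] -/

import Mathlib

open MeasureTheory ProbabilityTheory Filter Topology
open scoped NNReal ENNReal

noncomputable section

namespace KarlinModel

/-- `N` is a Poisson process with rate `lam` under `P`: it starts at `0`, has independent
increments, `N t - N s` is Poisson with mean `lam * (t - s)` for `s ≤ t`, and almost every path is
nondecreasing and right-continuous (the subtraction in `ℕ` is thus almost surely a true one). -/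
structure IsPoissonProcess {Ω : Type*} [MeasurableSpace Ω] (N : ℝ≥0 → Ω → ℕ) (lam : ℝ≥0)
    (P : Measure Ω) : Prop where
  measurable : ∀ t, Measurable (N t)
  start : ∀ᵐ ω ∂P, N 0 ω = 0
  indep : HasIndepIncrements N P
  law : ∀ s t : ℝ≥0, s ≤ t →
    HasLaw (fun ω => N t ω - N s ω) (poissonMeasure (lam * (t - s))) P
  paths : ∀ᵐ ω ∂P, Monotone (fun t => N t ω) ∧
    ∀ t, ContinuousWithinAt (fun s => N s ω) (Set.Ici t) t

/-- `M` is a Gaussian random measure on `E` with control measure `μ`: the variables `M A`, for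
measurable `A` with `μ A < ∞`, are jointly Gaussian and centered, and `Cov(M A, M B) = μ (A ∩ B)`.
The values of `M` on the other sets are irrelevant. -/
structure IsGaussianRandomMeasure {E Ω : Type*} [MeasurableSpace E] [MeasurableSpace Ω]
    (M : Set E → Ω → ℝ) (μ : Measure E) (P : Measure Ω) : Prop where
  gaussian : IsGaussianProcess
    (fun A : {A : Set E // MeasurableSet A ∧ μ A < ∞} => M A.1) P
  centered : ∀ A, MeasurableSet A → μ A < ∞ → ∫ ω, M A ω ∂P = 0
  cov : ∀ A B, MeasurableSet A → μ A < ∞ → MeasurableSet B → μ B < ∞ →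
    covariance (M A) (M B) P = μ.real (A ∩ B)

/-- The stochastic integral `∑ c, c * M {f = c}` of a simple function `f`. -/
def simpleIntegral {E Ω : Type*} [MeasurableSpace E]
    (M : Set E → Ω → ℝ) (f : SimpleFunc E ℝ) (ω : Ω) : ℝ :=
  ∑ c ∈ f.range, c * M (f ⁻¹' {c}) ω

/-- `X` is (a version of) the stochastic integral `∫ f dM` of `f ∈ L²(μ)`: it is the limit in
`L²(P)` of the integrals of simple functions that converge to `f` in `L²(μ)`. -/
structure IsStochasticIntegral {E Ω : Type*} [MeasurableSpace E] [MeasurableSpace Ω]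
    (M : Set E → Ω → ℝ) (μ : Measure E) (P : Measure Ω) (f : E → ℝ) (X : Ω → ℝ) : Prop where
  memLp_integrand : MemLp f 2 μ
  memLp : MemLp X 2 P
  approx : ∃ φ : ℕ → SimpleFunc E ℝ, (∀ k, MemLp (φ k) 2 μ) ∧
    Tendsto (fun k => eLpNorm (fun x => f x - φ k x) 2 μ) atTop (𝓝 0) ∧
    Tendsto (fun k => eLpNorm (fun ω => X ω - simpleIntegral M (φ k) ω) 2 P) atTop (𝓝 0)

open Classical in
/-- The stochastic integral `∫ f dM` with respect to a Gaussian random measure with control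
measure `μ` (unique up to null sets; `0` if there is none). -/
def stochasticIntegral {E Ω : Type*} [MeasurableSpace E] [MeasurableSpace Ω]
    (M : Set E → Ω → ℝ) (μ : Measure E) (P : Measure Ω) (f : E → ℝ) : Ω → ℝ :=
  if h : ∃ X, IsStochasticIntegral M μ P f X then h.choose else 0

/-- The measure `α r ^ (-α - 1) dr dP'` on `(0, ∞) × Ω'`, as a measure on `ℝ × Ω'`. -/
def intensity {Ω' : Type*} [MeasurableSpace Ω'] (α : ℝ) (P' : Measure Ω') : Measure (ℝ × Ω') :=
  (((volume : Measure ℝ).restrict (Set.Ioi 0)).withDensity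
    (fun r => ENNReal.ofReal (α * r ^ (-α - 1)))).prod P'

/-- The integrand `(r, ω') ↦ a_{N'(rt)}(ω') - E' a_{N'(rt)}`. -/
def kernelZ {Ω' : Type*} [MeasurableSpace Ω'] (a : ℕ → ℝ) (N' : ℝ≥0 → Ω' → ℕ) (P' : Measure Ω')
    (t : ℝ≥0) (x : ℝ × Ω') : ℝ :=
  a (N' (x.1.toNNReal * t) x.2) - ∫ ω', a (N' (x.1.toNNReal * t) ω') ∂P'

/-- The limit process `Z_α(t) = ∫ (a_{N'(rt)} - E' a_{N'(rt)}) M(dr, dω')`. -/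
def limitZ {Ω' Ω'' : Type*} [MeasurableSpace Ω'] [MeasurableSpace Ω''] (α : ℝ) (a : ℕ → ℝ)
    (N' : ℝ≥0 → Ω' → ℕ) (P' : Measure Ω') (M : Set (ℝ × Ω') → Ω'' → ℝ) (P'' : Measure Ω'')
    (t : ℝ≥0) : Ω'' → ℝ :=
  stochasticIntegral M (intensity α P') P'' (kernelZ a N' P' t)

/-- `v(x) = ∑ i, δ_{1 / p_i}([0, x])`, the number of `i` with `0 ≤ 1 / p_i ≤ x`. -/
def urnCount (p : ℕ → ℝ) (x : ℝ) : ℕ := {i : ℕ | 1 / p i ∈ Set.Icc 0 x}.ncard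

/-- The normalization `σ_n = v(n) ^ (1 / 2)`. -/
def sigma (p : ℕ → ℝ) (n : ℕ) : ℝ := √(urnCount p n)

/-- The number of urns with exactly `j` balls at time `s` in the Poissonized model. -/
def occupancy {Ω : Type*} (N : ℕ → ℝ≥0 → Ω → ℕ) (s : ℝ≥0) (j : ℕ) (ω : Ω) : ℝ :=
  ∑' l : ℕ, if N l s ω = j then 1 else 0

/-- The Poissonized weighted occupancy process
`W̃_n(t) = ∑_{j ≥ 1} a_j (D̃_{nt, j} - E D̃_{nt, j})`; the summation index is `j - 1`. -/
def poissonizedW {Ω : Type*} [MeasurableSpace Ω] (a : ℕ → ℝ) (N : ℕ → ℝ≥0 → Ω → ℕ) (P : Measure Ω)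
    (n : ℕ) (t : ℝ≥0) (ω : Ω) : ℝ :=
  ∑' j : ℕ, a (j + 1) *
    (occupancy N (n * t) (j + 1) ω - ∫ ω', occupancy N (n * t) (j + 1) ω' ∂P)

/-- Convergence of the finite-dimensional distributions of the processes `X n` to those of `Z`. -/
def FddTendsto {T Ω Ω'' : Type*} [MeasurableSpace Ω] [MeasurableSpace Ω'']
    (X : ℕ → T → Ω → ℝ) (P : Measure Ω) [IsProbabilityMeasure P]
    (Z : T → Ω'' → ℝ) (P'' : Measure Ω'') [IsProbabilityMeasure P''] : Prop :=
  ∀ (d : ℕ) (t : Fin d → T),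
    TendstoInDistribution (fun n ω => fun i : Fin d => X n (t i) ω) atTop
      (fun ω => fun i : Fin d => Z (t i) ω) (fun _ => P) P''

end KarlinModel

end

/-! Write `W̃_n` as a sum over urns of independent centered variables. A rate-`p_l` process at time
`nt` has, jointly in `t`, the law of `N'` at time `(n p_l) t` (`map_eq_map_rate_one`). Hence for a
fixed linear combination with coefficients `θ` and times `t_i`, urn `l` contributes the
characteristic function `ψ_n(n p_l)`, where `ψ_n(r) = E' exp(i Y_r / σ_n)` and `Y_r` is the same
combination of the integrands of `Z_α` at first coordinate `r`.

Since `Y_r` is centered, `σ_n² (ψ_n(r) - 1)` tends to `-E' Y_r² / 2`, and it is at most a constant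
times `min(r, r^(2β))`, uniformly in `n` (`tendsto_sq_mul_urnCharFun_sub_one`,
`norm_sq_mul_urnCharFun_sub_one_le`). Regular variation makes the measures `v(n)⁻¹ ∑ δ_{n p_l}`
converge to `α r^(-α-1) dr` on functions with such a bound, because `2β < α < 1`
(`tendsto_tsum_frequency_div_urnCount`). As `σ_n² = v(n)`, it follows that `∑ (ψ_n(n p_l) - 1)`
tends to minus one half of the squared `L²(μ)` norm of the combined integrand.

The product of the `ψ_n(n p_l)` differs from `exp ∑ (ψ_n(n p_l) - 1)` by at most `2 ∑ |ψ_n(n p_l) -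
1|²`, a sum with an extra factor `1 / v(n)` that tends to `0` (`norm_integral_exp_hasSum_sub_le`).
No Lindeberg condition is checked: second moments and dominated convergence suffice. By the Wiener
isometry the limit is the characteristic function of the stochastic integrals
(`integral_exp_sum_of_isStochasticIntegral`), and Lévy's continuity theorem concludes. -/

namespace KarlinModel

/-! ### Stochastic integrals against a Gaussian random measure -/

section StochasticIntegral

lemma integral_sq_eq_toReal_eLpNorm_sq {E : Type*} [MeasurableSpace E] {μ : Measure E} {g : E → ℝ}
    (hg : MemLp g 2 μ) : ∫ x, g x ^ 2 ∂μ = (eLpNorm g 2 μ).toReal ^ 2 := by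
  have h0 : 0 ≤ ∫ x, g x ^ 2 ∂μ := integral_nonneg fun x => sq_nonneg _
  rw [hg.eLpNorm_eq_integral_rpow_norm (by simp) (by simp)]
  simp only [ENNReal.toReal_ofNat, Real.rpow_two, Real.norm_eq_abs, sq_abs]
  rw [ENNReal.toReal_ofReal (by positivity), ← Real.rpow_natCast, ← Real.rpow_mul h0]
  simp

lemma tendsto_integral_sq_of_eLpNorm {E : Type*} [MeasurableSpace E] {μ : Measure E}
    {g : ℕ → E → ℝ} {f : E → ℝ} (hg : ∀ k, MemLp (g k) 2 μ) (hf : MemLp f 2 μ)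
    (h : Tendsto (fun k => eLpNorm (fun x => f x - g k x) 2 μ) atTop (𝓝 0)) :
    Tendsto (fun k => ∫ x, g k x ^ 2 ∂μ) atTop (𝓝 (∫ x, f x ^ 2 ∂μ)) := by
  simp_rw [fun k => integral_sq_eq_toReal_eLpNorm_sq (hg k), integral_sq_eq_toReal_eLpNorm_sq hf]
  refine Tendsto.pow ?_ 2
  refine (ENNReal.tendsto_toReal hf.eLpNorm_ne_top).comp ?_
  refine tendsto_of_tendsto_of_tendsto_of_le_of_le
    (g := fun k => eLpNorm f 2 μ - eLpNorm (fun x => f x - g k x) 2 μ)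
    (h := fun k => eLpNorm f 2 μ + eLpNorm (fun x => f x - g k x) 2 μ) ?_ ?_ ?_ ?_
  · simpa using ENNReal.Tendsto.sub (tendsto_const_nhds (x := eLpNorm f 2 μ)) h (by simp)
  · simpa using (tendsto_const_nhds (x := eLpNorm f 2 μ)).add h
  · intro k
    rw [tsub_le_iff_right]
    have := eLpNorm_add_le (hg k).1 (hf.sub (hg k)).1 (p := 2) (by norm_num)
    rwa [add_sub_cancel] at this
  · intro k
    have := eLpNorm_sub_le hf.1 (hf.sub (hg k)).1 (p := 2) (by norm_num)
    rwa [sub_sub_cancel] at this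

variable {E Ω : Type*} [MeasurableSpace E] [MeasurableSpace Ω] {M : Set E → Ω → ℝ}
  {μ : Measure E} {P : Measure Ω} [IsProbabilityMeasure P]

namespace IsGaussianRandomMeasure

omit [IsProbabilityMeasure P] in
lemma memLp_two (hM : IsGaussianRandomMeasure M μ P) {A : Set E} (hA : MeasurableSet A)
    (hA' : μ A < ∞) : MemLp (M A) 2 P :=
  (hM.gaussian.hasGaussianLaw_eval ⟨A, hA, hA'⟩).memLp_two

lemma integral_mul (hM : IsGaussianRandomMeasure M μ P) {A B : Set E} (hA : MeasurableSet A)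
    (hA' : μ A < ∞) (hB : MeasurableSet B) (hB' : μ B < ∞) :
    ∫ ω, M A ω * M B ω ∂P = μ.real (A ∩ B) := by
  have h := covariance_eq_sub (hM.memLp_two hA hA') (hM.memLp_two hB hB')
  rw [hM.cov A B hA hA' hB hB', hM.centered A hA hA'] at h
  simpa using h.symm

omit [IsProbabilityMeasure P] in
lemma hasGaussianLaw_sum (hM : IsGaussianRandomMeasure M μ P) {ι : Type*} (s : Finset ι)
    (c : ι → ℝ) (A : ι → Set E) (hA : ∀ i ∈ s, MeasurableSet (A i) ∧ μ (A i) < ∞) :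
    HasGaussianLaw (fun ω => ∑ i ∈ s, c i * M (A i) ω) P := by
  have h0 : IsGaussianProcess (fun (i : {i // i ∈ s}) => M (A i)) P := hM.gaussian.comp_right
    (fun i : {i // i ∈ s} => (⟨A i, hA i i.2⟩ : {A : Set E // MeasurableSet A ∧ μ A < ∞}))
  have h := (h0.smul (fun i : {i // i ∈ s} => c i)).hasGaussianLaw_fun_sum (I := s.attach)
  convert! h using 2 with ω
  rw [← Finset.sum_attach]
  rfl

lemma integral_sum (hM : IsGaussianRandomMeasure M μ P) {ι : Type*} (s : Finset ι)
    (c : ι → ℝ) (A : ι → Set E) (hA : ∀ i ∈ s, MeasurableSet (A i) ∧ μ (A i) < ∞) :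
    ∫ ω, ∑ i ∈ s, c i * M (A i) ω ∂P = 0 := by
  rw [integral_finsetSum _ fun i hi =>
    ((hM.memLp_two (hA i hi).1 (hA i hi).2).integrable (by norm_num)).const_mul _]
  refine Finset.sum_eq_zero fun i hi => ?_
  rw [integral_const_mul, hM.centered _ (hA i hi).1 (hA i hi).2, mul_zero]

/-- Both sides expand into the same double sum, because `E[M A * M B]` and the integral of the
product of the indicators are both `μ (A ∩ B)`. The sets may overlap, and additivity of `M`, which
is not part of its definition, is never needed. -/
lemma integral_sum_sq (hM : IsGaussianRandomMeasure M μ P) {ι : Type*} (s : Finset ι)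
    (c : ι → ℝ) (A : ι → Set E) (hA : ∀ i ∈ s, MeasurableSet (A i) ∧ μ (A i) < ∞) :
    ∫ ω, (∑ i ∈ s, c i * M (A i) ω) ^ 2 ∂P =
      ∫ x, (∑ i ∈ s, c i * (A i).indicator 1 x) ^ 2 ∂μ := by
  have hm i (hi : i ∈ s) := hM.memLp_two (hA i hi).1 (hA i hi).2
  have hμ i (hi : i ∈ s) j (hj : j ∈ s) : Integrable
      (fun x => c i * (A i).indicator 1 x * (c j * (A j).indicator 1 x)) μ := by
    have : (fun x => c i * (A i).indicator 1 x * (c j * (A j).indicator 1 x)) =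
        (A i ∩ A j).indicator (fun _ => c i * c j) := by
      funext x
      by_cases h1 : x ∈ A i <;> by_cases h2 : x ∈ A j <;> simp [h1, h2]
    rw [this, integrable_indicator_iff ((hA i hi).1.inter (hA j hj).1)]
    exact integrableOn_const (measure_ne_top_of_subset Set.inter_subset_left (hA i hi).2.ne)
  have hP i (hi : i ∈ s) j (hj : j ∈ s) : Integrable
      (fun ω => c i * M (A i) ω * (c j * M (A j) ω)) P :=
    ((hm i hi).const_mul (c i)).integrable_mul ((hm j hj).const_mul (c j))
  simp_rw [sq, Finset.sum_mul_sum]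
  rw [integral_finsetSum _ fun i hi => integrable_finsetSum _ fun j hj => hP i hi j hj,
    integral_finsetSum _ fun i hi => integrable_finsetSum _ fun j hj => hμ i hi j hj]
  refine Finset.sum_congr rfl fun i hi => ?_
  rw [integral_finsetSum _ fun j hj => hP i hi j hj,
    integral_finsetSum _ fun j hj => hμ i hi j hj]
  refine Finset.sum_congr rfl fun j hj => ?_
  have h1 : (fun ω => c i * M (A i) ω * (c j * M (A j) ω)) =
      fun ω => c i * c j * (M (A i) ω * M (A j) ω) := by funext ω; ring
  have h2 : (fun x => c i * (A i).indicator 1 x * (c j * (A j).indicator 1 x)) =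
      fun x => c i * c j * (A i ∩ A j).indicator 1 x := by
    funext x
    by_cases h1 : x ∈ A i <;> by_cases h2 : x ∈ A j <;> simp [h1, h2]
  rw [h1, h2, integral_const_mul, integral_const_mul, hM.integral_mul (hA i hi).1 (hA i hi).2
    (hA j hj).1 (hA j hj).2, integral_indicator_one ((hA i hi).1.inter (hA j hj).1)]

variable {d : Type*} [Fintype d]

-- The level set of `0` may have infinite measure, where `M` is unspecified. Its coefficient is `0`,
-- so it can be dropped; the remaining level sets of `L²` simple functions have finite measure.
omit [MeasurableSpace Ω] in
open Classical in
lemma sum_simpleIntegral_eq (θ : d → ℝ) (φ : d → SimpleFunc E ℝ) (ω : Ω) :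
    ∑ i, θ i * simpleIntegral M (φ i) ω =
      ∑ j ∈ Finset.univ.sigma (fun i => (φ i).range.filter (· ≠ 0)),
        (θ j.1 * j.2) * M (φ j.1 ⁻¹' {j.2}) ω := by
  rw [Finset.sum_sigma]
  refine Finset.sum_congr rfl fun i _ => ?_
  rw [simpleIntegral, Finset.mul_sum, Finset.sum_filter_of_ne]
  · exact Finset.sum_congr rfl fun c _ => by ring
  · rintro c - h rfl
    simp at h

open Classical in
lemma sum_simpleFunc_eq (θ : d → ℝ) (φ : d → SimpleFunc E ℝ) (x : E) :
    ∑ i, θ i * φ i x =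
      ∑ j ∈ Finset.univ.sigma (fun i => (φ i).range.filter (· ≠ 0)),
        (θ j.1 * j.2) * (φ j.1 ⁻¹' {j.2}).indicator 1 x := by
  rw [Finset.sum_sigma]
  refine Finset.sum_congr rfl fun i _ => ?_
  rw [Finset.sum_filter_of_ne]
  · rw [Finset.sum_eq_single (φ i x)]
    · simp
    · intro c _ hc
      simp [hc.symm]
    · simp
  · rintro c - h rfl
    simp at h

open Classical in
lemma measurableSet_preimage_of_memLp {φ : d → SimpleFunc E ℝ} (hφ : ∀ i, MemLp (φ i) 2 μ) :
    ∀ j ∈ Finset.univ.sigma (fun i => (φ i).range.filter (· ≠ 0)),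
      MeasurableSet (φ j.1 ⁻¹' {j.2}) ∧ μ (φ j.1 ⁻¹' {j.2}) < ∞ := by
  intro j hj
  simp only [Finset.mem_sigma, Finset.mem_filter] at hj
  exact ⟨(φ j.1).measurableSet_preimage _,
    SimpleFunc.measure_preimage_lt_top_of_memLp (by simp) (by simp) _ (hφ _) _ hj.2.2⟩

variable (hM : IsGaussianRandomMeasure M μ P) (θ : d → ℝ) {φ : d → SimpleFunc E ℝ}
  (hφ : ∀ i, MemLp (φ i) 2 μ)
include hM hφ

omit [IsProbabilityMeasure P] in
lemma hasGaussianLaw_sum_simpleIntegral :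
    HasGaussianLaw (fun ω => ∑ i, θ i * simpleIntegral M (φ i) ω) P := by
  simp_rw [sum_simpleIntegral_eq]
  exact hM.hasGaussianLaw_sum _ _ _ (measurableSet_preimage_of_memLp hφ)

lemma integral_sum_simpleIntegral :
    ∫ ω, ∑ i, θ i * simpleIntegral M (φ i) ω ∂P = 0 := by
  simp_rw [sum_simpleIntegral_eq]
  exact hM.integral_sum _ _ _ (measurableSet_preimage_of_memLp hφ)

lemma integral_sum_simpleIntegral_sq :
    ∫ ω, (∑ i, θ i * simpleIntegral M (φ i) ω) ^ 2 ∂P = ∫ x, (∑ i, θ i * φ i x) ^ 2 ∂μ := by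
  simp_rw [sum_simpleIntegral_eq, sum_simpleFunc_eq]
  exact hM.integral_sum_sq _ _ _ (measurableSet_preimage_of_memLp hφ)

lemma eLpNorm_sum_simpleIntegral :
    eLpNorm (fun ω => ∑ i, θ i * simpleIntegral M (φ i) ω) 2 P =
      eLpNorm (fun x => ∑ i, θ i * φ i x) 2 μ := by
  have h1 := (hM.hasGaussianLaw_sum_simpleIntegral θ hφ).memLp_two
  have h2 : MemLp (fun x => ∑ i, θ i * φ i x) 2 μ :=
    memLp_finsetSum _ fun i _ => (hφ i).const_mul _
  have h3 := hM.integral_sum_simpleIntegral_sq θ hφ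
  rw [integral_sq_eq_toReal_eLpNorm_sq h1, integral_sq_eq_toReal_eLpNorm_sq h2,
    sq_eq_sq₀ ENNReal.toReal_nonneg ENNReal.toReal_nonneg] at h3
  exact (ENNReal.toReal_eq_toReal_iff' h1.eLpNorm_ne_top h2.eLpNorm_ne_top).1 h3

lemma integral_exp_sum_simpleIntegral :
    ∫ ω, Complex.exp (Complex.I * (∑ i, θ i * simpleIntegral M (φ i) ω : ℝ)) ∂P =
      Complex.exp (-((∫ x, (∑ i, θ i * φ i x) ^ 2 ∂μ : ℝ) : ℂ) / 2) := by
  have h1 := hM.hasGaussianLaw_sum_simpleIntegral θ hφ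
  have h := h1.charFun_map_eq 1
  rw [charFun_apply_real, integral_map h1.aemeasurable (by fun_prop)] at h
  simp only [Complex.ofReal_one, one_mul, RCLike.inner_apply, conj_trivial, mul_one] at h
  rw [variance_of_integral_eq_zero h1.aemeasurable (hM.integral_sum_simpleIntegral θ hφ),
    hM.integral_sum_simpleIntegral θ hφ, hM.integral_sum_simpleIntegral_sq θ hφ] at h
  simp_rw [mul_comm Complex.I]
  rw [h]
  congr 1
  simp
  ring

end IsGaussianRandomMeasure

omit [IsProbabilityMeasure P] in
lemma memLp_simpleIntegral (hM : IsGaussianRandomMeasure M μ P) {φ : SimpleFunc E ℝ}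
    (hφ : MemLp φ 2 μ) : MemLp (simpleIntegral M φ) 2 P := by
  have := (hM.hasGaussianLaw_sum_simpleIntegral (d := Unit) (fun _ => 1) (φ := fun _ => φ)
    (fun _ => hφ)).memLp_two
  simpa using this

/-- The isometry is applied to the combination with coefficients `1` and `-1`, which avoids
identifying the difference of the integrals with the integral of `φ - ψ`. -/
lemma eLpNorm_simpleIntegral_sub (hM : IsGaussianRandomMeasure M μ P) {φ ψ : SimpleFunc E ℝ}
    (hφ : MemLp φ 2 μ) (hψ : MemLp ψ 2 μ) :
    eLpNorm (simpleIntegral M φ - simpleIntegral M ψ) 2 P = eLpNorm (⇑φ - ⇑ψ) 2 μ := by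
  have := hM.eLpNorm_sum_simpleIntegral (d := Fin 2) ![1, -1] (φ := ![φ, ψ])
    (by simp [Fin.forall_fin_two, hφ, hψ])
  simp only [Fin.sum_univ_two, Matrix.cons_val_zero, Matrix.cons_val_one, one_mul, neg_mul,
    ← sub_eq_add_neg] at this
  exact this

/-- Every square integrable function has a stochastic integral. -/
lemma exists_isStochasticIntegral (hM : IsGaussianRandomMeasure M μ P) {f : E → ℝ}
    (hf : MemLp f 2 μ) : ∃ X, IsStochasticIntegral M μ P f X := by
  -- Errors of `2⁻ⁿ / 2` make two approximants beyond index `N` differ by less than `2⁻ᴺ`, a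
  -- summable Cauchy bound.
  have hB0 : ∀ n : ℕ, ((2 : ℝ≥0∞)⁻¹ ^ n) / 2 ≠ 0 := fun n => by simp
  choose φ hφ hφ' using fun n => hf.exists_simpleFunc_eLpNorm_sub_lt (by simp) (hB0 n)
  have hcau : ∀ N n m : ℕ, N ≤ n → N ≤ m →
      eLpNorm (simpleIntegral M (φ n) - simpleIntegral M (φ m)) 2 P < (2 : ℝ≥0∞)⁻¹ ^ N := by
    intro N n m hn hm
    rw [eLpNorm_simpleIntegral_sub hM (hφ' n) (hφ' m)]
    have hle : ∀ k, N ≤ k → eLpNorm (f - ⇑(φ k)) 2 μ < (2 : ℝ≥0∞)⁻¹ ^ N / 2 := fun k hk =>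
      (hφ k).trans_le (ENNReal.div_le_div_right (pow_le_pow_of_le_one (by simp) (by simp) hk) _)
    calc eLpNorm (⇑(φ n) - ⇑(φ m)) 2 μ = eLpNorm ((f - ⇑(φ m)) - (f - ⇑(φ n))) 2 μ := by
          rw [sub_sub_sub_cancel_left]
      _ ≤ eLpNorm (f - ⇑(φ m)) 2 μ + eLpNorm (f - ⇑(φ n)) 2 μ :=
          eLpNorm_sub_le (hf.sub (hφ' m)).1 (hf.sub (hφ' n)).1 (by norm_num)
      _ < (2 : ℝ≥0∞)⁻¹ ^ N / 2 + (2 : ℝ≥0∞)⁻¹ ^ N / 2 := ENNReal.add_lt_add (hle m hm) (hle n hn)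
      _ = (2 : ℝ≥0∞)⁻¹ ^ N := ENNReal.add_halves _
  obtain ⟨X, hX, hlim⟩ := Lp.cauchy_complete_eLpNorm (by norm_num)
    (fun n => memLp_simpleIntegral hM (hφ' n)) (B := fun n => (2 : ℝ≥0∞)⁻¹ ^ n)
    (by simp [ENNReal.tsum_geometric]) hcau
  refine ⟨X, hf, hX, φ, hφ', ?_, ?_⟩
  · have h2 : Tendsto (fun n : ℕ => (2 : ℝ≥0∞)⁻¹ ^ n / 2) atTop (𝓝 0) := by
      have := ENNReal.Tendsto.div_const (ENNReal.tendsto_pow_atTop_nhds_zero_of_lt_one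
        (r := (2 : ℝ≥0∞)⁻¹) (by simp)) (b := 2) (by simp)
      simpa using this
    exact tendsto_of_tendsto_of_tendsto_of_le_of_le tendsto_const_nhds h2 (fun _ => zero_le)
      (fun n => (hφ n).le)
  · simp_rw [eLpNorm_sub_comm _ X] at hlim
    exact hlim

lemma isStochasticIntegral_stochasticIntegral (hM : IsGaussianRandomMeasure M μ P) {f : E → ℝ}
    (hf : MemLp f 2 μ) : IsStochasticIntegral M μ P f (stochasticIntegral M μ P f) := by
  have h := exists_isStochasticIntegral hM hf
  rw [stochasticIntegral, dif_pos h]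
  exact h.choose_spec

lemma tendsto_eLpNorm_sum_sub {F : Type*} [MeasurableSpace F] {ν : Measure F}
    {d : Type*} [Fintype d]
    (θ : d → ℝ) {f : d → F → ℝ} {g : d → ℕ → F → ℝ} (hf : ∀ i, MemLp (f i) 2 ν)
    (hg : ∀ i k, MemLp (g i k) 2 ν)
    (h : ∀ i, Tendsto (fun k => eLpNorm (fun x => f i x - g i k x) 2 ν) atTop (𝓝 0)) :
    Tendsto (fun k => eLpNorm (fun x => ∑ i, θ i * f i x - ∑ i, θ i * g i k x) 2 ν)
      atTop (𝓝 0) := by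
  have hb : ∀ k, eLpNorm (fun x => ∑ i, θ i * f i x - ∑ i, θ i * g i k x) 2 ν ≤
      ∑ i, ‖θ i‖ₑ * eLpNorm (fun x => f i x - g i k x) 2 ν := by
    intro k
    have h1 : (fun x => ∑ i, θ i * f i x - ∑ i, θ i * g i k x) =
        ∑ i, θ i • (fun x => f i x - g i k x) := by
      funext x
      simp [Finset.sum_apply, mul_sub]
    rw [h1]
    refine (eLpNorm_sum_le (fun i _ => (((hf i).sub (hg i k)).const_smul (θ i)).1)
      (by norm_num)).trans (Finset.sum_le_sum fun i _ => ?_)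
    rw [eLpNorm_const_smul]
    rfl
  refine tendsto_of_tendsto_of_tendsto_of_le_of_le tendsto_const_nhds ?_ (fun _ => zero_le) hb
  have := tendsto_finsetSum Finset.univ fun i _ =>
    ENNReal.Tendsto.const_mul (h i) (Or.inr (enorm_ne_top (x := θ i)))
  simpa using this

lemma norm_exp_I_mul_sub_exp_I_mul_le (x y : ℝ) :
    ‖Complex.exp (Complex.I * x) - Complex.exp (Complex.I * y)‖ ≤ ‖x - y‖ := by
  have : Complex.exp (Complex.I * x) - Complex.exp (Complex.I * y) =
      Complex.exp (Complex.I * y) * (Complex.exp (Complex.I * ((x - y : ℝ) : ℂ)) - 1) := by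
    rw [mul_sub, ← Complex.exp_add, mul_one]
    congr 2
    push_cast
    ring
  rw [this, norm_mul, Complex.norm_exp_I_mul_ofReal, one_mul]
  exact Real.norm_exp_I_mul_ofReal_sub_one_le

lemma integrable_exp_I_mul {F : Type*} [MeasurableSpace F] {ν : Measure F} [IsFiniteMeasure ν]
    {f : F → ℝ} (hf : AEMeasurable f ν) :
    Integrable (fun x => Complex.exp (Complex.I * f x)) ν := by
  refine (integrable_const (1 : ℝ)).mono' ?_ (ae_of_all _ fun x => ?_)
  · have : Continuous fun x : ℝ => Complex.exp (Complex.I * x) := by fun_prop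
    exact this.comp_aestronglyMeasurable hf.aestronglyMeasurable
  · rw [Complex.norm_exp_I_mul_ofReal]

/-- The map `x ↦ exp(ix)` is 1-Lipschitz, and the `L¹` norm is at most the `L²` norm on a
probability space. -/
lemma tendsto_integral_exp_of_eLpNorm {X : Ω → ℝ} {Y : ℕ → Ω → ℝ} (hX : MemLp X 2 P)
    (hY : ∀ k, MemLp (Y k) 2 P)
    (h : Tendsto (fun k => eLpNorm (fun ω => X ω - Y k ω) 2 P) atTop (𝓝 0)) :
    Tendsto (fun k => ∫ ω, Complex.exp (Complex.I * Y k ω) ∂P) atTop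
      (𝓝 (∫ ω, Complex.exp (Complex.I * X ω) ∂P)) := by
  rw [tendsto_iff_norm_sub_tendsto_zero]
  refine squeeze_zero (g := fun k => (eLpNorm (fun ω => X ω - Y k ω) 2 P).toReal)
    (fun _ => norm_nonneg _) (fun k => ?_)
    ((ENNReal.tendsto_toReal ENNReal.zero_ne_top).comp h)
  have hXY : MemLp (fun ω => X ω - Y k ω) 2 P := hX.sub (hY k)
  rw [← integral_sub (integrable_exp_I_mul (hY k).1.aemeasurable)
    (integrable_exp_I_mul hX.1.aemeasurable)]
  calc ‖∫ ω, (Complex.exp (Complex.I * Y k ω) - Complex.exp (Complex.I * X ω)) ∂P‖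
      ≤ ∫ ω, ‖X ω - Y k ω‖ ∂P := by
        refine norm_integral_le_of_norm_le (hXY.integrable (by norm_num)).norm
          (ae_of_all _ fun ω => ?_)
        rw [norm_sub_rev (X ω)]
        exact norm_exp_I_mul_sub_exp_I_mul_le _ _
    _ = (eLpNorm (fun ω => X ω - Y k ω) 1 P).toReal := by
        rw [eLpNorm_one_eq_lintegral_enorm, integral_norm_eq_lintegral_enorm hXY.1]
    _ ≤ _ := ENNReal.toReal_mono hXY.eLpNorm_ne_top
        (eLpNorm_le_eLpNorm_of_exponent_le (by norm_num) hXY.1)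

/-- The joint characteristic function of stochastic integrals. -/
lemma integral_exp_sum_of_isStochasticIntegral (hM : IsGaussianRandomMeasure M μ P)
    {d : Type*} [Fintype d] (θ : d → ℝ) {f : d → E → ℝ} {X : d → Ω → ℝ}
    (h : ∀ i, IsStochasticIntegral M μ P (f i) (X i)) :
    ∫ ω, Complex.exp (Complex.I * (∑ i, θ i * X i ω : ℝ)) ∂P =
      Complex.exp (-((∫ x, (∑ i, θ i * f i x) ^ 2 ∂μ : ℝ) : ℂ) / 2) := by
  choose φ hφ hf hX using fun i => (h i).approx
  have hI i k := memLp_simpleIntegral hM (hφ i k)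
  have h1 := tendsto_integral_exp_of_eLpNorm
    (memLp_finsetSum Finset.univ fun i _ => (h i).memLp.const_mul (θ i))
    (fun k => memLp_finsetSum Finset.univ fun i _ => (hI i k).const_mul (θ i))
    (tendsto_eLpNorm_sum_sub θ (fun i => (h i).memLp) hI hX)
  have h2 := tendsto_integral_sq_of_eLpNorm
    (fun k => memLp_finsetSum Finset.univ fun i _ => (hφ i k).const_mul (θ i))
    (memLp_finsetSum Finset.univ fun i _ => (h i).memLp_integrand.const_mul (θ i))
    (tendsto_eLpNorm_sum_sub θ (fun i => (h i).memLp_integrand) hφ hf)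
  simp_rw [fun k => hM.integral_exp_sum_simpleIntegral θ (fun i => hφ i k)] at h1
  refine tendsto_nhds_unique h1 ?_
  have hc : Continuous fun v : ℝ => Complex.exp (-(v : ℂ) / 2) := by fun_prop
  exact (hc.tendsto _).comp h2

end StochasticIntegral

/-! ### Regular variation: from sums over frequencies to integrals -/

section RegularVariation

/-- Each integer is the floor of a unit interval. This turns sums over urns into Lebesgue integrals,
to which dominated convergence applies after rescaling. -/
lemma map_floor_restrict_Ioi :
    ((volume : Measure ℝ).restrict (Set.Ioi 0)).map (Nat.floor : ℝ → ℕ) = Measure.count := by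
  rw [restrict_Ioi_eq_restrict_Ici]
  refine Measure.ext_of_singleton fun l => ?_
  rw [Measure.map_apply Nat.measurable_floor (measurableSet_singleton l),
    Measure.restrict_apply (Nat.measurable_floor (measurableSet_singleton l)),
    Measure.count_singleton]
  have : (Nat.floor : ℝ → ℕ) ⁻¹' {l} ∩ Set.Ici 0 = Set.Ico (l : ℝ) (l + 1) := by
    ext x
    simp only [Set.mem_inter_iff, Set.mem_preimage, Set.mem_singleton_iff, Set.mem_Ici,
      Set.mem_Ico]
    constructor
    · rintro ⟨h, hx⟩
      exact (Nat.floor_eq_iff hx).1 h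
    · intro h
      have hx : 0 ≤ x := (Nat.cast_nonneg l).trans h.1
      exact ⟨(Nat.floor_eq_iff hx).2 h, hx⟩
  rw [this]
  simp

lemma integral_floor_eq_tsum {F : Type*} [NormedAddCommGroup F] [NormedSpace ℝ F]
    [CompleteSpace F] {g : ℕ → F} (hg : Summable fun l => ‖g l‖) :
    ∫ x in Set.Ioi (0 : ℝ), g ⌊x⌋₊ = ∑' l, g l := by
  have hi : Integrable g Measure.count := by
    rw [integrable_count_iff]
    exact hg
  rw [← map_floor_restrict_Ioi] at hi
  rw [← integral_map (φ := (Nat.floor : ℝ → ℕ)) Nat.measurable_floor.aemeasurable hi.1]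
  rw [map_floor_restrict_Ioi] at hi ⊢
  rw [integral_countable hi]
  simp

lemma min_rpow_mono {γ : ℝ} (hγ : 0 ≤ γ) {r s : ℝ} (hr : 0 ≤ r) (h : r ≤ s) :
    min r (r ^ γ) ≤ min s (s ^ γ) :=
  min_le_min h (Real.rpow_le_rpow hr h hγ)

lemma min_rpow_mul_le {γ : ℝ} (hγ : γ ≤ 1) {c r : ℝ} (hc : 1 ≤ c) (hr : 0 ≤ r) :
    min (c * r) ((c * r) ^ γ) ≤ c * min r (r ^ γ) := by
  have hc0 : 0 ≤ c := zero_le_one.trans hc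
  rw [mul_min_of_nonneg _ _ hc0, Real.mul_rpow hc0 hr]
  refine min_le_min le_rfl (mul_le_mul_of_nonneg_right ?_ (Real.rpow_nonneg hr _))
  calc c ^ γ ≤ c ^ (1 : ℝ) := Real.rpow_le_rpow_of_exponent_le hc hγ
    _ = c := Real.rpow_one c

variable {α : ℝ}

/-- Near `0` the integrand is at most `α r^(-α)`, integrable since `α < 1`; near infinity it is at
most `α r^(γ-α-1)`, integrable since `γ < α`. -/
lemma integrableOn_rpow_mul_min (hα : α ∈ Set.Ioo (0 : ℝ) 1) {γ : ℝ} (hγα : γ < α) :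
    IntegrableOn (fun r : ℝ => α * r ^ (-α - 1) * min r (r ^ γ)) (Set.Ioi 0) := by
  have hmeas : Measurable (fun r : ℝ => α * r ^ (-α - 1) * min r (r ^ γ)) := by fun_prop
  have h1 : IntegrableOn (fun r : ℝ => α * r ^ (-α)) (Set.Ioc 0 1) := by
    have := (intervalIntegral.intervalIntegrable_rpow' (a := 0) (b := 1) (r := -α)
      (by linarith [hα.2])).const_mul α
    rwa [intervalIntegrable_iff_integrableOn_Ioc_of_le zero_le_one] at this
  have h2 : IntegrableOn (fun r : ℝ => α * r ^ (γ - α - 1)) (Set.Ioi 1) :=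
    (integrableOn_Ioi_rpow_of_lt (by linarith) one_pos).const_mul α
  have hpos : ∀ r : ℝ, 0 < r → 0 ≤ min r (r ^ γ) := fun r hr =>
    le_min hr.le (Real.rpow_nonneg hr.le _)
  rw [← Set.Ioc_union_Ioi_eq_Ioi zero_le_one]
  refine IntegrableOn.union ?_ ?_
  · refine h1.mono' hmeas.aestronglyMeasurable
      ((ae_restrict_iff' measurableSet_Ioc).2 (ae_of_all _ fun r hr => ?_))
    have hr0 : 0 < r := hr.1
    rw [Real.norm_of_nonneg (mul_nonneg (mul_nonneg hα.1.le (Real.rpow_nonneg hr0.le _))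
      (hpos r hr0)), mul_assoc]
    refine mul_le_mul_of_nonneg_left ?_ hα.1.le
    calc r ^ (-α - 1) * min r (r ^ γ) ≤ r ^ (-α - 1) * r :=
          mul_le_mul_of_nonneg_left (min_le_left _ _) (Real.rpow_nonneg hr0.le _)
      _ = r ^ (-α) := by rw [← Real.rpow_add_one hr0.ne']; ring_nf
  · refine h2.mono' hmeas.aestronglyMeasurable
      ((ae_restrict_iff' measurableSet_Ioi).2 (ae_of_all _ fun r hr => ?_))
    have hr0 : 0 < r := one_pos.trans hr
    rw [Real.norm_of_nonneg (mul_nonneg (mul_nonneg hα.1.le (Real.rpow_nonneg hr0.le _))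
      (hpos r hr0)), mul_assoc]
    refine mul_le_mul_of_nonneg_left ?_ hα.1.le
    calc r ^ (-α - 1) * min r (r ^ γ) ≤ r ^ (-α - 1) * r ^ γ :=
          mul_le_mul_of_nonneg_left (min_le_right _ _) (Real.rpow_nonneg hr0.le _)
      _ = r ^ (γ - α - 1) := by rw [← Real.rpow_add hr0]; ring_nf

lemma rpow_neg_rpow_neg_inv (hα : 0 < α) {r : ℝ} (hr : 0 ≤ r) : (r ^ (-α)) ^ (-(1 / α)) = r := by
  rw [← Real.rpow_mul hr, neg_mul_neg, mul_one_div, div_self hα.ne', Real.rpow_one]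

lemma integrableOn_min_rpow_inv (hα : α ∈ Set.Ioo (0 : ℝ) 1) {γ : ℝ} (hγα : γ < α) :
    IntegrableOn (fun u : ℝ => min (u ^ (-(1 / α))) ((u ^ (-(1 / α))) ^ γ)) (Set.Ioi 0) := by
  rw [← integrableOn_Ioi_comp_rpow_iff _ (neg_ne_zero.2 hα.1.ne')]
  refine (integrableOn_rpow_mul_min hα hγα).congr_fun (fun r hr => ?_) measurableSet_Ioi
  simp only [smul_eq_mul, abs_neg, abs_of_pos hα.1]
  rw [rpow_neg_rpow_neg_inv hα.1 (le_of_lt hr)]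

/-- Substitute `u = r^(-α)`. Here `u` plays the role of the rank of an urn in units of `(C₀ n)^α`,
and `r` that of its expected number of balls. -/
lemma integral_comp_rpow_inv {F : Type*} [NormedAddCommGroup F] [NormedSpace ℝ F]
    (hα : 0 < α) (g : ℝ → F) :
    ∫ u in Set.Ioi (0 : ℝ), g (u ^ (-(1 / α))) =
      ∫ r in Set.Ioi (0 : ℝ), (α * r ^ (-α - 1)) • g r := by
  rw [← integral_comp_rpow_Ioi (fun u => g (u ^ (-(1 / α)))) (neg_ne_zero.2 hα.ne')]
  refine setIntegral_congr_fun measurableSet_Ioi fun r hr => ?_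
  simp only [abs_neg, abs_of_pos hα]
  rw [rpow_neg_rpow_neg_inv hα (le_of_lt hr)]

variable {p : ℕ → ℝ} {C₀ : ℝ}

/-- A nonincreasing summable sequence is nonnegative, and the asymptotics give nonzero terms beyond
every index; monotonicity passes positivity down. -/
lemma frequency_pos (hp_anti : Antitone p) (hp_sum : Summable p)
    (hp : Tendsto (fun l : ℕ => p l / (C₀ * ((l : ℝ) + 1) ^ (-(1 / α)))) atTop (𝓝 1)) (l : ℕ) :
    0 < p l := by
  have h0 : ∀ k, 0 ≤ p k := fun k => hp_anti.le_of_tendsto hp_sum.tendsto_atTop_zero k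
  obtain ⟨k, hk, hlk⟩ := ((hp.eventually_ne one_ne_zero).and (eventually_ge_atTop l)).exists
  have hk' : p k ≠ 0 := by
    rintro h
    simp [h] at hk
  exact ((h0 k).lt_of_ne hk'.symm).trans_le (hp_anti hlk)

variable (hα : α ∈ Set.Ioo (0 : ℝ) 1) (hC₀ : 0 < C₀)
  (hp : Tendsto (fun l : ℕ => p l / (C₀ * ((l : ℝ) + 1) ^ (-(1 / α)))) atTop (𝓝 1))

-- The rank `(C₀ n)^α` is where the asymptotic frequency equals `1 / n`; it serves as the
-- deterministic scale until it is replaced by `v(n)`.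
include hα hC₀ in
lemma scale_rpow_inv {n : ℕ} : (((C₀ * n) ^ α) : ℝ) ^ (-(1 / α)) = (C₀ * n)⁻¹ := by
  have hx : 0 ≤ C₀ * (n : ℝ) := by positivity
  rw [← Real.rpow_mul hx, mul_neg, mul_one_div, div_self hα.1.ne', Real.rpow_neg_one]

include hα hC₀ in
lemma tendsto_scale : Tendsto (fun n : ℕ => (C₀ * n) ^ α) atTop atTop :=
  (tendsto_rpow_atTop hα.1).comp (tendsto_natCast_atTop_atTop.const_mul_atTop hC₀)

include hα hC₀ hp in
lemma tendsto_frequency_floor {u : ℝ} (hu : 0 < u) :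
    Tendsto (fun n : ℕ => n * p ⌊(C₀ * n) ^ α * u⌋₊) atTop (𝓝 (u ^ (-(1 / α)))) := by
  set m : ℕ → ℝ := fun n => (C₀ * n) ^ α with hm
  have hmt : Tendsto m atTop atTop := tendsto_scale hα hC₀
  have hk : Tendsto (fun n => ⌊m n * u⌋₊) atTop atTop :=
    tendsto_nat_floor_atTop.comp (hmt.atTop_mul_const hu)
  have h1 : Tendsto (fun n => ((⌊m n * u⌋₊ : ℝ) + 1) / m n) atTop (𝓝 u) := by
    have h2 := (tendsto_nat_floor_mul_div_atTop hu.le).comp hmt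
    have h3 : Tendsto (fun n => 1 / m n) atTop (𝓝 0) := by
      simpa only [one_div] using! tendsto_inv_atTop_zero.comp hmt
    have := h2.add h3
    rw [add_zero] at this
    refine this.congr fun n => ?_
    simp only [Function.comp, mul_comm u]
    ring
  have h4 := (Real.continuousAt_rpow_const u (-(1 / α)) (Or.inl hu.ne')).tendsto.comp h1
  have h5 := (hp.comp hk).mul h4
  rw [one_mul] at h5
  refine h5.congr' ?_
  filter_upwards [eventually_gt_atTop 0] with n hn
  have hn' : (0 : ℝ) < n := by exact_mod_cast hn
  have hmn : 0 ≤ m n := Real.rpow_nonneg (by positivity) _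
  simp only [Function.comp]
  rw [Real.div_rpow (by positivity) hmn, scale_rpow_inv hα hC₀]
  have hpos : 0 < ((⌊m n * u⌋₊ : ℝ) + 1) ^ (-(1 / α)) := by positivity
  change _ = n * p ⌊m n * u⌋₊
  generalize p ⌊m n * u⌋₊ = q
  field_simp

-- The ratio in `hp` is bounded, and `⌊x⌋ + 1 ≥ x` under a negative exponent. The shift by one in
-- the labelling of urns makes the bound valid for all `u > 0`, so it can serve as a dominating
-- function.
include hα hC₀ hp in
lemma exists_frequency_floor_le (hpos : ∀ l, 0 < p l) :
    ∃ c : ℝ, 1 ≤ c ∧ ∀ (n : ℕ) (u : ℝ), 0 < n → 0 < u →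
      n * p ⌊(C₀ * n) ^ α * u⌋₊ ≤ c * u ^ (-(1 / α)) := by
  obtain ⟨c, hc⟩ := hp.bddAbove_range
  refine ⟨max c 1, le_max_right _ _, fun n u hn hu => ?_⟩
  set m : ℝ := (C₀ * n) ^ α with hm
  have hn' : (0 : ℝ) < n := by exact_mod_cast hn
  have hm0 : 0 < m := by positivity
  set k := ⌊m * u⌋₊ with hk
  have h1 : p k ≤ c * (C₀ * ((k : ℝ) + 1) ^ (-(1 / α))) := by
    have h := hc (Set.mem_range_self k)
    rwa [div_le_iff₀ (by positivity)] at h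
  have hc0 : 0 ≤ c := by
    refine le_trans ?_ (hc (Set.mem_range_self k))
    have := hpos k
    positivity
  have h2 : ((k : ℝ) + 1) ^ (-(1 / α)) ≤ (m * u) ^ (-(1 / α)) :=
    Real.rpow_le_rpow_of_nonpos (by positivity) (Nat.lt_floor_add_one _).le
      (by have := hα.1; simp only [Left.neg_nonpos_iff]; positivity)
  have hu' : 0 ≤ u ^ (-(1 / α)) := by positivity
  calc n * p k ≤ n * (c * (C₀ * (m * u) ^ (-(1 / α)))) := by gcongr; exact h1.trans (by gcongr)
    _ = c * u ^ (-(1 / α)) := by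
        rw [Real.mul_rpow hm0.le hu.le, hm, scale_rpow_inv hα hC₀]
        field_simp
    _ ≤ max c 1 * u ^ (-(1 / α)) := by gcongr; exact le_max_left _ _

include hα hC₀ hp in
/-- Sums over the rescaled frequencies converge to the integral against
`α r ^ (-α - 1) dr`. -/
theorem tendsto_tsum_frequency (hpos : ∀ l, 0 < p l) (hsum : Summable p)
    {F : Type*} [NormedAddCommGroup F] [NormedSpace ℝ F] [CompleteSpace F]
    {γ : ℝ} (hγ : 0 ≤ γ) (hγα : γ < α) {K : ℝ} {g : ℕ → ℝ → F} {g' : ℝ → F}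
    (hbound : ∀ n r, 0 < r → ‖g n r‖ ≤ K * min r (r ^ γ))
    (hlim : ∀ (r : ℝ) (s : ℕ → ℝ), 0 < r → r ≠ 1 → Tendsto s atTop (𝓝 r) →
      Tendsto (fun n => g n (s n)) atTop (𝓝 (g' r))) :
    Tendsto (fun n : ℕ => ((C₀ * n) ^ α)⁻¹ • ∑' l, g n (n * p l)) atTop
      (𝓝 (∫ r in Set.Ioi (0 : ℝ), (α * r ^ (-α - 1)) • g' r)) := by
  rw [← integral_comp_rpow_inv hα.1]
  obtain ⟨c, hc1, hc⟩ := exists_frequency_floor_le hα hC₀ hp hpos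
  have hK : 0 ≤ K := by
    have := (norm_nonneg _).trans (hbound 0 1 one_pos)
    simpa using this
  have key : Tendsto (fun n : ℕ => ∫ u in Set.Ioi (0 : ℝ), g n (n * p ⌊(C₀ * n) ^ α * u⌋₊)) atTop
      (𝓝 (∫ u in Set.Ioi (0 : ℝ), g' (u ^ (-(1 / α))))) := by
    refine tendsto_integral_filter_of_dominated_convergence
      (fun u => K * (c * min (u ^ (-(1 / α))) ((u ^ (-(1 / α))) ^ γ))) ?_ ?_ ?_ ?_
    · refine Eventually.of_forall fun n => ?_
      -- Only the values of `g n` at the points `n p_k` enter, so `g n` itself need not be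
      -- measurable.
      have h : StronglyMeasurable fun k : ℕ => g n (n * p k) := .of_discrete
      exact (h.comp_measurable (Nat.measurable_floor.comp
        (measurable_const_mul ((C₀ * (n : ℝ)) ^ α)))).aestronglyMeasurable
    · filter_upwards [eventually_gt_atTop 0] with n hn
      refine (ae_restrict_iff' measurableSet_Ioi).2 (ae_of_all _ fun u hu => ?_)
      have hn' : (0 : ℝ) < n := by exact_mod_cast hn
      have hq : 0 < (n : ℝ) * p ⌊(C₀ * n) ^ α * u⌋₊ := mul_pos hn' (hpos _)
      refine (hbound n _ hq).trans (mul_le_mul_of_nonneg_left ?_ hK)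
      exact (min_rpow_mono hγ hq.le (hc n u hn hu)).trans
        (min_rpow_mul_le (hγα.le.trans hα.2.le) hc1 (Real.rpow_nonneg (le_of_lt hu) _))
    · exact ((integrableOn_min_rpow_inv hα hγα).const_mul c).const_mul K
    -- The point `r = 1`, that is `u = 1`, is null. Excluding it admits the indicator of `[1, ∞)`,
    -- which is how `v(n)` itself is treated.
    · have h1 : ∀ᵐ u : ℝ ∂(volume.restrict (Set.Ioi 0)), u ≠ 1 :=
        ae_restrict_of_ae (Measure.ae_ne volume 1)
      filter_upwards [h1, ae_restrict_mem measurableSet_Ioi] with u hu1 hu0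
      have hu0' : 0 < u := hu0
      refine hlim _ _ (by positivity) ?_ (tendsto_frequency_floor hα hC₀ hp hu0)
      intro h
      exact hu1 ((Real.rpow_left_inj hu0'.le zero_le_one
        (neg_ne_zero.2 (one_div_ne_zero hα.1.ne'))).1 (h.trans (Real.one_rpow _).symm))
  refine key.congr' ?_
  filter_upwards [eventually_gt_atTop 0] with n hn
  have hn' : (0 : ℝ) < n := by exact_mod_cast hn
  have hm0 : 0 < (C₀ * (n : ℝ)) ^ α := by positivity
  rw [integral_comp_mul_left_Ioi (fun x => g n (n * p ⌊x⌋₊)) 0 hm0, mul_zero,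
    integral_floor_eq_tsum (g := fun l => g n (n * p l))]
  refine Summable.of_nonneg_of_le (fun _ => norm_nonneg _)
    (fun l => (hbound n _ (mul_pos hn' (hpos l))).trans
      (mul_le_mul_of_nonneg_left (min_le_left _ _) hK)) ?_
  exact (hsum.mul_left (n : ℝ)).mul_left K

lemma urnCount_eq_tsum (hpos : ∀ l, 0 < p l) (hsum : Summable p) (n : ℕ) :
    (urnCount p n : ℝ) = ∑' l, (Set.Ici (1 : ℝ)).indicator 1 (n * p l) := by
  have hS : {i : ℕ | 1 / p i ∈ Set.Icc 0 (n : ℝ)} = {i : ℕ | 1 ≤ n * p i} := by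
    ext i
    have := hpos i
    simp only [Set.mem_ofPred_eq, Set.mem_Icc, one_div, inv_nonneg, this.le, true_and]
    rw [inv_le_iff_one_le_mul₀ this]
  have hfin : {i : ℕ | 1 ≤ n * p i}.Finite := by
    have h := (hsum.mul_left (n : ℝ)).tendsto_atTop_zero.eventually_lt_const one_pos
    rw [← Nat.cofinite_eq_atTop] at h
    refine (Filter.eventually_cofinite.1 h).subset fun i hi => ?_
    simpa using hi
  rw [urnCount, hS, tsum_eq_sum (s := hfin.toFinset)]
  · rw [Set.ncard_eq_toFinset_card _ hfin, Finset.sum_congr rfl (g := fun _ => (1 : ℝ))]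
    · simp
    · intro i hi
      have : 1 ≤ n * p i := by simpa using hi
      simp [this]
  · intro i hi
    have : ¬ 1 ≤ n * p i := by simpa using hi
    simp [Set.indicator, this]

include hα hC₀ hp in
/-- The number of urns with frequency at least `1 / n` is asymptotic to `(C₀ n) ^ α`. -/
theorem tendsto_urnCount_div (hpos : ∀ l, 0 < p l) (hsum : Summable p) :
    Tendsto (fun n : ℕ => ((C₀ * n) ^ α)⁻¹ * (urnCount p n : ℝ)) atTop (𝓝 1) := by
  -- Here `γ = 0`: the indicator of `[1, ∞)` is at most `min r 1`, and its integral against `α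
  -- r^(-α-1) dr` is `1`.
  have h := tendsto_tsum_frequency hα hC₀ hp hpos hsum le_rfl hα.1 (K := 1)
    (g := fun _ => (Set.Ici (1 : ℝ)).indicator (1 : ℝ → ℝ))
    (g' := (Set.Ici (1 : ℝ)).indicator (1 : ℝ → ℝ)) ?_ ?_
  · simp_rw [← urnCount_eq_tsum hpos hsum] at h
    convert! h using 2
    have h1 : ∀ r : ℝ, (α * r ^ (-α - 1)) • (Set.Ici (1 : ℝ)).indicator (1 : ℝ → ℝ) r =
        (Set.Ici (1 : ℝ)).indicator (fun r => α * r ^ (-α - 1)) r := by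
      intro r
      by_cases hr : r ∈ Set.Ici (1 : ℝ) <;> simp [hr]
    rw [setIntegral_congr_fun measurableSet_Ioi fun r _ => h1 r, setIntegral_indicator measurableSet_Ici,
      Set.inter_eq_right.2 (Set.Ici_subset_Ioi.2 one_pos), integral_Ici_eq_integral_Ioi,
      integral_const_mul, integral_Ioi_rpow_of_lt (by linarith [hα.1]) one_pos]
    have := hα.1.ne'
    simp [this]
  · intro n r hr
    by_cases h1 : 1 ≤ r
    · simp [h1]
    · simp [Set.indicator, h1, hr.le]
  · intro r s hr hr1 hs
    refine tendsto_const_nhds.congr' ?_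
    rcases lt_or_gt_of_ne hr1 with h | h
    · filter_upwards [hs.eventually_lt_const h] with n hn
      simp [Set.indicator, hn.not_ge, h.not_ge]
    · filter_upwards [hs.eventually_const_lt h] with n hn
      simp [Set.indicator, hn.le, h.le]

include hα hC₀ hp in
/-- Sums over the rescaled frequencies, normalized by the number of urns. -/
theorem tendsto_tsum_frequency_div_urnCount (hpos : ∀ l, 0 < p l) (hsum : Summable p)
    {F : Type*} [NormedAddCommGroup F] [NormedSpace ℝ F] [CompleteSpace F]
    {γ : ℝ} (hγ : 0 ≤ γ) (hγα : γ < α) {K : ℝ} {g : ℕ → ℝ → F} {g' : ℝ → F}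
    (hbound : ∀ n r, 0 < r → ‖g n r‖ ≤ K * min r (r ^ γ))
    (hlim : ∀ (r : ℝ) (s : ℕ → ℝ), 0 < r → r ≠ 1 → Tendsto s atTop (𝓝 r) →
      Tendsto (fun n => g n (s n)) atTop (𝓝 (g' r))) :
    Tendsto (fun n : ℕ => (urnCount p n : ℝ)⁻¹ • ∑' l, g n (n * p l)) atTop
      (𝓝 (∫ r in Set.Ioi (0 : ℝ), (α * r ^ (-α - 1)) • g' r)) := by
  have h1 := tendsto_tsum_frequency hα hC₀ hp hpos hsum hγ hγα hbound hlim
  have h2 := (tendsto_urnCount_div hα hC₀ hp hpos hsum).inv₀ one_ne_zero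
  have h3 := h2.smul h1
  rw [inv_one, one_smul] at h3
  refine h3.congr' ?_
  filter_upwards [eventually_gt_atTop 0] with n hn
  have hn' : (0 : ℝ) < n := by exact_mod_cast hn
  have hm0 : ((C₀ * (n : ℝ)) ^ α) ≠ 0 := by positivity
  rw [smul_smul, mul_inv, inv_inv, mul_right_comm, mul_inv_cancel₀ hm0, one_mul]

include hα hC₀ hp in
lemma tendsto_urnCount (hpos : ∀ l, 0 < p l) (hsum : Summable p) :
    Tendsto (fun n : ℕ => (urnCount p n : ℝ)) atTop atTop := by
  have h := (tendsto_scale hα hC₀).atTop_mul_pos one_pos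
    (tendsto_urnCount_div hα hC₀ hp hpos hsum)
  refine h.congr' ?_
  filter_upwards [eventually_gt_atTop 0] with n hn
  have hn' : (0 : ℝ) < n := by exact_mod_cast hn
  have hm0 : ((C₀ * (n : ℝ)) ^ α) ≠ 0 := by positivity
  rw [mul_inv_cancel_left₀ hm0]

end RegularVariation

/-! ### Moments of the Poisson law -/

section PoissonMoments

lemma hasSum_poissonMeasure_mul_natCast (r : ℝ≥0) :
    HasSum (fun n : ℕ => Real.exp (-r) * (r : ℝ) ^ n / (n.factorial : ℝ) * n) r := by
  rw [← hasSum_nat_add_iff' 1]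
  have h := (hasSum_one_poissonMeasure r).mul_left (r : ℝ)
  simp only [mul_one, Finset.range_one, Finset.sum_singleton, CharP.cast_eq_zero, mul_zero,
    sub_zero] at h ⊢
  refine h.congr_fun fun n => ?_
  have : ((n.factorial : ℝ)) ≠ 0 := by positivity
  rw [Nat.factorial_succ]
  push_cast
  field_simp
  ring

lemma integrable_natCast_poissonMeasure (r : ℝ≥0) :
    Integrable (fun n : ℕ => (n : ℝ)) (poissonMeasure r) := by
  rw [integrable_poissonMeasure_iff]
  simpa using (hasSum_poissonMeasure_mul_natCast r).summable

lemma integral_natCast_poissonMeasure (r : ℝ≥0) :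
    ∫ n : ℕ, (n : ℝ) ∂poissonMeasure r = r := by
  rw [integral_poissonMeasure]
  simpa using (hasSum_poissonMeasure_mul_natCast r).tsum_eq

lemma poissonMeasure_compl_zero_le (r : ℝ≥0) : poissonMeasure r {0}ᶜ ≤ r := by
  rw [prob_compl_eq_one_sub (measurableSet_singleton 0), poissonMeasure_singleton]
  simp only [pow_zero, mul_one, Nat.factorial_zero, Nat.cast_one, div_one]
  rw [← ENNReal.ofReal_one, ← ENNReal.ofReal_sub _ (Real.exp_pos _).le]
  calc ENNReal.ofReal (1 - Real.exp (-r)) ≤ ENNReal.ofReal r := by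
        refine ENNReal.ofReal_le_ofReal ?_
        have := Real.add_one_le_exp (-(r : ℝ))
        linarith
    _ = r := ENNReal.ofReal_coe_nnreal

/-- The power `k ^ γ`, set to `0` at `k = 0` also for `γ = 0`. -/
noncomputable def powWeight (γ : ℝ) (k : ℕ) : ℝ := if k = 0 then 0 else (k : ℝ) ^ γ

lemma powWeight_nonneg (γ : ℝ) (k : ℕ) : 0 ≤ powWeight γ k := by
  unfold powWeight
  split_ifs <;> positivity

lemma powWeight_sq (γ : ℝ) (k : ℕ) : powWeight γ k ^ 2 = powWeight (2 * γ) k := by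
  unfold powWeight
  split_ifs with h
  · simp
  · rw [mul_comm, Real.rpow_mul (by positivity)]
    simp

lemma powWeight_le {γ : ℝ} (hγ : γ ≤ 1) (k : ℕ) : powWeight γ k ≤ k := by
  unfold powWeight
  split_ifs with h
  · positivity
  · have h1 : (1 : ℝ) ≤ k := by exact_mod_cast Nat.one_le_iff_ne_zero.2 h
    calc (k : ℝ) ^ γ ≤ (k : ℝ) ^ (1 : ℝ) := Real.rpow_le_rpow_of_exponent_le h1 hγ
      _ = k := Real.rpow_one _

/-- A linear majorant that replaces Jensen's inequality: its expectation is `2 r^γ` when the mean of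
`k` is `r`. -/
lemma powWeight_le_rpow_mul {γ : ℝ} (hγ0 : 0 ≤ γ) (hγ : γ ≤ 1) {r : ℝ} (hr : 0 < r) (k : ℕ) :
    powWeight γ k ≤ r ^ γ * (1 + k / r) := by
  unfold powWeight
  split_ifs with h
  · positivity
  · have h1 : (0 : ℝ) ≤ k / r := by positivity
    calc (k : ℝ) ^ γ = r ^ γ * (k / r) ^ γ := by
          rw [← Real.mul_rpow hr.le h1, mul_div_cancel₀ _ hr.ne']
      _ ≤ r ^ γ * (1 + k / r) := by
          gcongr
          calc ((k : ℝ) / r) ^ γ ≤ (1 + k / r) ^ γ := by gcongr; linarith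
            _ ≤ (1 + k / r) ^ (1 : ℝ) := Real.rpow_le_rpow_of_exponent_le (by linarith) hγ
            _ = _ := Real.rpow_one _

end PoissonMoments

/-! ### Poisson processes: moments and continuity at a fixed time -/

namespace IsPoissonProcess

variable {Ω : Type*} [MeasurableSpace Ω] {P : Measure Ω} {N : ℝ≥0 → Ω → ℕ} {lam : ℝ≥0}

lemma hasLaw (h : IsPoissonProcess N lam P) (t : ℝ≥0) :
    HasLaw (N t) (poissonMeasure (lam * t)) P := by
  have := h.law 0 t zero_le
  rw [tsub_zero] at this
  refine this.congr ?_
  filter_upwards [h.start] with ω hω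
  simp [hω]

lemma isProbabilityMeasure (h : IsPoissonProcess N lam P) : IsProbabilityMeasure P :=
  (h.hasLaw 0).isProbabilityMeasure

lemma integrable (h : IsPoissonProcess N lam P) (t : ℝ≥0) :
    Integrable (fun ω => (N t ω : ℝ)) P :=
  (integrable_map_measure (f := N t) (g := fun n : ℕ => (n : ℝ)) (by fun_prop)
    (h.hasLaw t).aemeasurable).1
    ((h.hasLaw t).map_eq ▸ integrable_natCast_poissonMeasure (lam * t))

lemma integral_eq (h : IsPoissonProcess N lam P) (t : ℝ≥0) :
    ∫ ω, (N t ω : ℝ) ∂P = lam * t := by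
  have := (h.hasLaw t).integral_comp (f := fun n : ℕ => (n : ℝ)) (by fun_prop)
  simp only [Function.comp_def] at this
  rw [this, integral_natCast_poissonMeasure]
  simp

lemma integrable_powWeight (h : IsPoissonProcess N lam P) {γ : ℝ} (hγ : γ ≤ 1) (t : ℝ≥0) :
    Integrable (fun ω => powWeight γ (N t ω)) P := by
  refine (h.integrable t).mono' ?_ (ae_of_all _ fun ω => ?_)
  · exact ((measurable_of_countable (powWeight γ)).comp (h.measurable t)).aestronglyMeasurable
  · rw [Real.norm_of_nonneg (powWeight_nonneg _ _)]
    exact powWeight_le hγ _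

/-- The weight vanishes at `0` and is at most `k`, which gives the bound `r` needed for rare urns;
the linear majorant gives `2 r^γ`, needed for frequent ones. -/
lemma integral_powWeight_le (h : IsPoissonProcess N lam P) {γ : ℝ} (hγ0 : 0 ≤ γ) (hγ : γ ≤ 1)
    (t : ℝ≥0) :
    ∫ ω, powWeight γ (N t ω) ∂P ≤ 2 * min ((lam * t : ℝ≥0) : ℝ) (((lam * t : ℝ≥0) : ℝ) ^ γ) := by
  have := h.isProbabilityMeasure
  have h1 : ∫ ω, powWeight γ (N t ω) ∂P ≤ ((lam * t : ℝ≥0) : ℝ) := by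
    calc _ ≤ ∫ ω, (N t ω : ℝ) ∂P := integral_mono (h.integrable_powWeight hγ t) (h.integrable t)
          fun ω => powWeight_le hγ _
      _ = _ := by rw [h.integral_eq]; simp
  rcases eq_or_lt_of_le (zero_le (a := lam * t)) with h0 | h0
  · rw [← h0] at h1 ⊢
    refine h1.trans ?_
    simp only [NNReal.coe_zero]
    positivity
  · have hr : (0 : ℝ) < ((lam * t : ℝ≥0) : ℝ) := by exact_mod_cast h0
    set r : ℝ := ((lam * t : ℝ≥0) : ℝ) with hrdef
    have h2 : ∫ ω, powWeight γ (N t ω) ∂P ≤ 2 * r ^ γ := by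
      calc _ ≤ ∫ ω, r ^ γ * (1 + N t ω / r) ∂P := by
            refine integral_mono (h.integrable_powWeight hγ t) ?_
              fun ω => powWeight_le_rpow_mul hγ0 hγ hr _
            exact ((integrable_const _).add ((h.integrable t).div_const r)).const_mul _
        _ = 2 * r ^ γ := by
            rw [integral_const_mul, integral_add (integrable_const _)
              ((h.integrable t).div_const r), integral_div, h.integral_eq]
            have : (lam : ℝ) * t = r := by rw [hrdef]; simp
            rw [this, div_self hr.ne']
            simp
            ring
    rw [mul_min_of_nonneg _ _ two_pos.le]
    exact le_min (by linarith) h2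

/-- At a fixed time, almost every path is locally constant. -/
lemma ae_eventually_eq (h : IsPoissonProcess N lam P) (s : ℝ≥0) :
    ∀ᵐ ω ∂P, ∀ᶠ u in 𝓝 s, N u ω = N s ω := by
  -- A monotone path with zero increment over `[s - ε, s + ε]` is constant there; a nonzero
  -- increment has probability at most `2 lam ε`.
  have hε : ∀ k : ℕ, P {ω | N (s + 1 / (k + 1)) ω - N (s - 1 / (k + 1)) ω ≠ 0} ≤
      ((lam * (2 * (1 / (k + 1))) : ℝ≥0) : ℝ≥0∞) := by
    intro k
    have hle : s - 1 / ((k : ℝ≥0) + 1) ≤ s + 1 / (k + 1) := tsub_le_self.trans le_self_add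
    have hl := h.law _ _ hle
    have : {ω | N (s + 1 / (k + 1)) ω - N (s - 1 / (k + 1)) ω ≠ 0} =
      (fun ω => N (s + 1 / (k + 1)) ω - N (s - 1 / (k + 1)) ω) ⁻¹' {0}ᶜ := rfl
    rw [this, ← Measure.map_apply_of_aemeasurable hl.aemeasurable
      (measurableSet_singleton 0).compl, hl.map_eq]
    refine (poissonMeasure_compl_zero_le _).trans (ENNReal.coe_le_coe.2 ?_)
    gcongr
    rw [tsub_le_iff_left, two_mul, ← add_assoc]
    gcongr
    exact le_tsub_add
  have h0 : P {ω | ∀ k : ℕ, N (s + 1 / (k + 1)) ω - N (s - 1 / (k + 1)) ω ≠ 0} = 0 := by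
    have hlim : Tendsto (fun k : ℕ => ((lam * (2 * (1 / (k + 1))) : ℝ≥0) : ℝ≥0∞)) atTop (𝓝 0) := by
      rw [← ENNReal.coe_zero, ENNReal.tendsto_coe]
      have := ((tendsto_one_div_add_atTop_nhds_zero_nat (𝕜 := ℝ≥0)).const_mul 2).const_mul lam
      simpa using this
    refine le_antisymm (ge_of_tendsto' hlim fun k =>
      (measure_mono (Set.ofPred_subset_ofPred.2 fun ω hω => hω k)).trans (hε k))
      zero_le
  have h1 : ∀ᵐ ω ∂P, ∃ k : ℕ, N (s + 1 / (k + 1)) ω - N (s - 1 / (k + 1)) ω = 0 := by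
    rw [ae_iff]
    simpa using h0
  filter_upwards [h1, h.paths] with ω ⟨k, hk⟩ ⟨hmono, _⟩
  have hpos : (0 : ℝ≥0) < 1 / ((k : ℝ≥0) + 1) := by positivity
  have hu1 : ∀ᶠ u in 𝓝 s, u ≤ s + 1 / ((k : ℝ≥0) + 1) :=
    eventually_le_nhds (lt_add_of_pos_right s hpos)
  have hu2 : ∀ᶠ u in 𝓝 s, s - 1 / ((k : ℝ≥0) + 1) ≤ u := by
    have : Tendsto (fun u : ℝ≥0 => u + 1 / ((k : ℝ≥0) + 1)) (𝓝 s)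
        (𝓝 (s + 1 / ((k : ℝ≥0) + 1))) := by
      exact (continuous_id.add continuous_const).tendsto s
    filter_upwards [this.eventually_const_le (lt_add_of_pos_right s hpos)] with u hu
    exact tsub_le_iff_right.2 hu
  filter_upwards [hu1, hu2] with u hu1 hu2
  have e1 : N (s + 1 / (k + 1)) ω ≤ N (s - 1 / (k + 1)) ω := Nat.sub_eq_zero_iff_le.1 hk
  have e2 := hmono hu1
  have e3 := hmono hu2
  have e4 : N s ω ≤ N (s + 1 / (k + 1)) ω := hmono le_self_add
  have e5 : N (s - 1 / (k + 1)) ω ≤ N s ω := hmono tsub_le_self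
  simp only at e2 e3
  omega

/-- Almost surely the integer vector is eventually constant in `n`, so convergence of `G n k` at
each fixed `k` suffices. Monotone paths give the dominating function: the counts at an upper bound
`R` of the sequence `s`. -/
lemma tendsto_integral_comp (h : IsPoissonProcess N lam P) {d : Type*} [Fintype d]
    {F : Type*} [NormedAddCommGroup F] [NormedSpace ℝ F] {t : d → ℝ≥0} {s : ℕ → ℝ≥0} {r : ℝ≥0}
    (hs : Tendsto s atTop (𝓝 r)) {G : ℕ → (d → ℕ) → F} {G' : (d → ℕ) → F} {K : ℝ}
    (hG : ∀ k, Tendsto (fun n => G n k) atTop (𝓝 (G' k)))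
    (hb : ∀ n k, ‖G n k‖ ≤ K * (1 + ∑ i, (k i : ℝ))) :
    Tendsto (fun n => ∫ ω, G n (fun i => N (s n * t i) ω) ∂P) atTop
      (𝓝 (∫ ω, G' (fun i => N (r * t i) ω) ∂P)) := by
  have := h.isProbabilityMeasure
  have hK : 0 ≤ K := by
    have := (norm_nonneg _).trans (hb 0 0)
    simpa using this
  obtain ⟨R, hR⟩ := hs.bddAbove_range
  refine tendsto_integral_of_dominated_convergence
    (fun ω => K * (1 + ∑ i, (N (R * t i) ω : ℝ))) (fun n => ?_) ?_ (fun n => ?_) ?_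
  · have hm : Measurable fun ω => fun i => N (s n * t i) ω :=
      measurable_pi_lambda _ fun i => h.measurable _
    exact (StronglyMeasurable.of_discrete (f := G n)).comp_measurable hm |>.aestronglyMeasurable
  · exact ((integrable_const _).add (integrable_finsetSum _ fun i _ => h.integrable _)).const_mul K
  · filter_upwards [h.paths] with ω ⟨hmono, _⟩
    refine (hb _ _).trans ?_
    gcongr with i
    exact_mod_cast hmono (mul_le_mul_left (hR (Set.mem_range_self n)) (t i))
  · have h1 : ∀ᵐ ω ∂P, ∀ i, ∀ᶠ u in 𝓝 (r * t i), N u ω = N (r * t i) ω :=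
      ae_all_iff.2 fun i => h.ae_eventually_eq _
    filter_upwards [h1] with ω hω
    refine (hG _).congr' ?_
    have h2 : ∀ᶠ n in atTop, ∀ i, N (s n * t i) ω = N (r * t i) ω :=
      eventually_all.2 fun i => (hs.mul_const (t i)).eventually (hω i)
    filter_upwards [h2] with n hn
    simp_rw [hn]

end IsPoissonProcess

/-! ### Poisson processes: time change and joint measurability -/

lemma exists_monotone_enumeration {d : ℕ} (t : Fin d → ℝ≥0) :
    ∃ τ : ℕ → ℝ≥0, Monotone τ ∧ τ 0 = 0 ∧ ∀ i, ∃ k, τ k = t i := by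
  classical
  set σ := Tuple.sort t
  have hσ : Monotone (t ∘ σ) := Tuple.monotone_sort t
  -- The time `0` is put in front, whence the shift `k - 1`, so that partial sums of increments
  -- recover the values; after the last time the sequence stays at the maximum.
  refine ⟨fun k => if k = 0 then 0 else if h : k - 1 < d then t (σ ⟨k - 1, h⟩)
    else Finset.univ.sup t, ?_, by simp, fun i => ⟨σ.symm i + 1, by simp⟩⟩
  intro k l hkl
  by_cases hk : k = 0
  · simp [hk]
  have hl : l ≠ 0 := by omega
  by_cases h1 : k - 1 < d <;> by_cases h2 : l - 1 < d
  · simp only [hk, hl, h1, h2, if_false, dif_pos]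
    exact hσ (Fin.mk_le_mk.2 (by omega))
  · simp only [hk, hl, h1, h2, if_false, dif_pos, dif_neg, not_false_eq_true]
    exact Finset.le_sup (Finset.mem_univ _)
  · omega
  · simp [hk, hl, h1, h2]

namespace IsPoissonProcess

variable {Ω Ω' : Type*} [MeasurableSpace Ω] [MeasurableSpace Ω'] {P : Measure Ω} {P' : Measure Ω'}
  {N : ℝ≥0 → Ω → ℕ} {N' : ℝ≥0 → Ω' → ℕ} {lam : ℝ≥0}

/-- Independent increments have a product law, and the values are their partial sums. Monotonicity
of almost every path makes the truncated subtractions in `ℕ` telescope. -/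
lemma map_sequence_eq (h : IsPoissonProcess N lam P) {τ : ℕ → ℝ≥0} (hτ : Monotone τ)
    (hτ0 : τ 0 = 0) :
    P.map (fun ω k => N (τ k) ω) =
      (Measure.infinitePi fun k => poissonMeasure (lam * (τ (k + 1) - τ k))).map
        (fun x k => ∑ j ∈ Finset.range k, x j) := by
  have := h.isProbabilityMeasure
  have hD := h.indep.nat hτ
  have hDm : ∀ k, Measurable fun ω => N (τ (k + 1)) ω - N (τ k) ω := fun k =>
    (h.measurable _).sub (h.measurable _)
  have hmap := (iIndepFun_iff_map_fun_eq_infinitePi_map hDm).1 hD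
  have hlaw : ∀ k, P.map (fun ω => N (τ (k + 1)) ω - N (τ k) ω) =
      poissonMeasure (lam * (τ (k + 1) - τ k)) := fun k => (h.law _ _ (hτ (Nat.le_succ k))).map_eq
  simp_rw [hlaw] at hmap
  have hS : Measurable fun (x : ℕ → ℕ) (k : ℕ) => ∑ j ∈ Finset.range k, x j := by fun_prop
  rw [← hmap, Measure.map_map hS (measurable_pi_lambda _ hDm)]
  refine Measure.map_congr ?_
  filter_upwards [h.start, h.paths] with ω h0 ⟨hmono, _⟩
  funext k
  have := Finset.sum_range_tsub (f := fun k => N (τ k) ω) (fun a b hab => hmono (hτ hab)) k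
  simp only [Function.comp]
  rw [this, hτ0, h0, Nat.sub_zero]

/-- The finite-dimensional distributions of a Poisson process depend on its rate only through a
change of time. -/
lemma map_eq_map_rate_one (h : IsPoissonProcess N lam P) (h' : IsPoissonProcess N' 1 P') {d : ℕ}
    (t : Fin d → ℝ≥0) :
    P.map (fun ω i => N (t i) ω) = P'.map (fun ω i => N' (lam * t i) ω) := by
  obtain ⟨τ, hτ, hτ0, hτt⟩ := exists_monotone_enumeration t
  choose κ hκ using hτt
  have h1 := h.map_sequence_eq hτ hτ0
  have h2 := h'.map_sequence_eq (τ := fun k => lam * τ k)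
    (fun a b hab => by have := hτ hab; dsimp only; gcongr) (by simp [hτ0])
  simp_rw [one_mul, ← mul_tsub] at h2
  rw [← h2] at h1
  have hm : Measurable fun (x : ℕ → ℕ) (i : Fin d) => x (κ i) := by fun_prop
  have h3 := congrArg (Measure.map (fun (x : ℕ → ℕ) (i : Fin d) => x (κ i))) h1
  rw [Measure.map_map hm (measurable_pi_lambda _ fun k => h.measurable _),
    Measure.map_map hm (measurable_pi_lambda _ fun k => h'.measurable _)] at h3
  simpa only [Function.comp_def, hκ] using h3

/-- A Poisson process is jointly measurable in time and randomness, up to null sets. -/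
lemma aemeasurable_uncurry (h : IsPoissonProcess N lam P) {S : Type*} [MeasurableSpace S]
    {ν : Measure S} [SFinite ν] {q : S → ℝ≥0} (hq : Measurable q) :
    AEMeasurable (fun x : S × Ω => N (q x.1) x.2) (ν.prod P) := by
  have := h.isProbabilityMeasure
  -- The times `D n s / (n + 1)` exceed `s` by at most `1 / (n + 1)`, so right-continuity applies.
  -- They take countably many values, so each approximant is measurable.
  let D : ℕ → ℝ≥0 → ℕ := fun n s => ⌊(n + 1 : ℝ≥0) * s⌋₊ + 1
  have hD : ∀ n, Measurable (D n) := fun n =>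
    (Nat.measurable_floor.comp (measurable_const_mul _)).add_const 1
  refine aemeasurable_of_tendsto_metrizable_ae atTop
    (f := fun n (x : S × Ω) => N ((D n (q x.1) : ℝ≥0) / (n + 1)) x.2) (fun n => ?_) ?_
  · have h1 : Measurable fun y : ℕ × Ω => N ((y.1 : ℝ≥0) / (n + 1)) y.2 :=
      measurable_from_prod_countable_right fun k => h.measurable ((k : ℝ≥0) / (n + 1))
    exact (h1.comp (((hD n).comp (hq.comp measurable_fst)).prodMk measurable_snd)).aemeasurable
  · have h2 : ∀ᵐ x ∂(ν.prod P), ∀ t, ContinuousWithinAt (fun s => N s x.2) (Set.Ici t) t :=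
      Measure.quasiMeasurePreserving_snd.ae (h.paths.mono fun ω hω => hω.2)
    filter_upwards [h2] with x hx
    refine (hx (q x.1)).tendsto.comp (tendsto_nhdsWithin_iff.2
      ⟨?_, Eventually.of_forall fun n => ?_⟩)
    · have hlt : ∀ n : ℕ, (D n (q x.1) : ℝ≥0) / (n + 1) ≤ q x.1 + 1 / ((n : ℝ≥0) + 1) := by
        intro n
        have hf : ((⌊(n + 1 : ℝ≥0) * q x.1⌋₊ : ℕ) : ℝ≥0) ≤ (n + 1) * q x.1 :=
          Nat.floor_le zero_le
        have hn : (0 : ℝ≥0) < n + 1 := by positivity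
        rw [div_le_iff₀ hn, add_mul, one_div, inv_mul_cancel₀ hn.ne']
        simp only [D]
        push_cast
        rw [mul_comm (q x.1)]
        gcongr
      have hge : ∀ n : ℕ, q x.1 ≤ (D n (q x.1) : ℝ≥0) / (n + 1) := by
        intro n
        have hn : (0 : ℝ≥0) < n + 1 := by positivity
        rw [le_div_iff₀ hn, mul_comm]
        simp only [D]
        push_cast
        exact (Nat.lt_floor_add_one _).le
      refine tendsto_of_tendsto_of_tendsto_of_le_of_le tendsto_const_nhds ?_ hge hlt
      simpa using tendsto_const_nhds.add (tendsto_one_div_add_atTop_nhds_zero_nat (𝕜 := ℝ≥0))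
    · have hn : (0 : ℝ≥0) < n + 1 := by positivity
      rw [Set.mem_Ici, le_div_iff₀ hn, mul_comm]
      simp only [D]
      push_cast
      exact (Nat.lt_floor_add_one _).le

end IsPoissonProcess

/-! ### Square integrability of the integrand -/

section Integrand

lemma abs_le_mul_powWeight {a : ℕ → ℝ} (ha₀ : a 0 = 0) {β C : ℝ}
    (ha : ∀ j : ℕ, 1 ≤ j → |a j| ≤ C * (j : ℝ) ^ β) (k : ℕ) : |a k| ≤ C * powWeight β k := by
  by_cases h : k = 0
  · simp [h, ha₀, powWeight]
  · simpa [powWeight, h] using ha k (Nat.one_le_iff_ne_zero.2 h)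

lemma sq_sum_mul_le {a : ℕ → ℝ} {β C : ℝ} (ha : ∀ k, |a k| ≤ C * powWeight β k)
    {d : Type*} [Fintype d] (θ : d → ℝ) (k : d → ℕ) :
    (∑ i, θ i * a (k i)) ^ 2 ≤ (C ^ 2 * ∑ i, θ i ^ 2) * ∑ i, powWeight (2 * β) (k i) := by
  calc (∑ i, θ i * a (k i)) ^ 2 ≤ (∑ i, θ i ^ 2) * ∑ i, a (k i) ^ 2 :=
        Finset.sum_mul_sq_le_sq_mul_sq _ _ _
    _ ≤ (∑ i, θ i ^ 2) * ∑ i, C ^ 2 * powWeight (2 * β) (k i) := by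
        gcongr with i
        rw [← powWeight_sq, ← mul_pow, ← sq_abs]
        exact pow_le_pow_left₀ (abs_nonneg _) (ha _) 2
    _ = _ := by rw [← Finset.mul_sum]; ring

lemma sq_sum_mul_le_sum {a : ℕ → ℝ} {β C : ℝ} (hβ : 2 * β ≤ 1)
    (ha : ∀ k, |a k| ≤ C * powWeight β k) {d : Type*} [Fintype d] (θ : d → ℝ) (k : d → ℕ) :
    (∑ i, θ i * a (k i)) ^ 2 ≤ (C ^ 2 * ∑ i, θ i ^ 2) * ∑ i, (k i : ℝ) := by
  refine (sq_sum_mul_le ha θ k).trans ?_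
  gcongr
  exact powWeight_le hβ _

variable {Ω : Type*} [MeasurableSpace Ω] {P : Measure Ω} {N : ℝ≥0 → Ω → ℕ} {lam : ℝ≥0}
  {a : ℕ → ℝ} {β C : ℝ} {d : Type*} [Fintype d]

lemma IsPoissonProcess.memLp_two_sum (h : IsPoissonProcess N lam P) (hβ : 2 * β ≤ 1)
    (ha : ∀ k, |a k| ≤ C * powWeight β k) (θ : d → ℝ) (s : d → ℝ≥0) :
    MemLp (fun ω => ∑ i, θ i * a (N (s i) ω)) 2 P := by
  have hm : Measurable fun ω => ∑ i, θ i * a (N (s i) ω) :=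
    Finset.measurable_sum _ fun i _ =>
      ((measurable_of_countable a).comp (h.measurable _)).const_mul _
  refine (memLp_two_iff_integrable_sq hm.aestronglyMeasurable).2 ?_
  refine ((integrable_finsetSum Finset.univ fun i _ => h.integrable (s i)).const_mul
    (C ^ 2 * ∑ i, θ i ^ 2)).mono' (hm.pow_const 2).aestronglyMeasurable (ae_of_all _ fun ω => ?_)
  rw [Real.norm_of_nonneg (sq_nonneg _)]
  exact sq_sum_mul_le_sum hβ ha θ _

lemma IsPoissonProcess.memLp_two (h : IsPoissonProcess N lam P) (hβ : 2 * β ≤ 1)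
    (ha : ∀ k, |a k| ≤ C * powWeight β k) (s : ℝ≥0) :
    MemLp (fun ω => a (N s ω)) 2 P := by
  simpa using h.memLp_two_sum hβ ha (d := Unit) (fun _ => 1) (fun _ => s)

lemma IsPoissonProcess.sum_kernelZ_eq (h : IsPoissonProcess N lam P) (hβ : 2 * β ≤ 1)
    (ha : ∀ k, |a k| ≤ C * powWeight β k) (θ : d → ℝ) (t : d → ℝ≥0) (r : ℝ) (ω : Ω) :
    ∑ i, θ i * kernelZ a N P (t i) (r, ω) = ∑ i, θ i * a (N (r.toNNReal * t i) ω) -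
      ∫ ω', ∑ i, θ i * a (N (r.toNNReal * t i) ω') ∂P := by
  have := h.isProbabilityMeasure
  rw [integral_finsetSum _ fun i _ =>
    ((h.memLp_two hβ ha (r.toNNReal * t i)).integrable (by norm_num)).const_mul (θ i)]
  simp_rw [integral_const_mul, ← Finset.sum_sub_distrib, ← mul_sub]
  rfl

/-- The variance of a linear combination of the integrands at a fixed first coordinate. -/
lemma IsPoissonProcess.integral_sq_sum_kernelZ_le (h : IsPoissonProcess N 1 P) (hβ0 : 0 ≤ β)
    (hβ : 2 * β ≤ 1) (ha : ∀ k, |a k| ≤ C * powWeight β k) (θ : d → ℝ) (t : d → ℝ≥0) {r : ℝ}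
    (hr : 0 < r) :
    ∫ ω, (∑ i, θ i * kernelZ a N P (t i) (r, ω)) ^ 2 ∂P ≤
      ((C ^ 2 * ∑ i, θ i ^ 2) * ∑ i, 2 * max 1 (t i : ℝ)) * min r (r ^ (2 * β)) := by
  have := h.isProbabilityMeasure
  have hA := h.memLp_two_sum hβ ha θ (fun i => r.toNNReal * t i)
  simp_rw [h.sum_kernelZ_eq hβ ha]
  rw [← variance_eq_integral hA.1.aemeasurable]
  refine (variance_le_expectation_sq hA.1).trans ?_
  have hterm : ∀ i, ∫ ω, powWeight (2 * β) (N (r.toNNReal * t i) ω) ∂P ≤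
      2 * max 1 (t i : ℝ) * min r (r ^ (2 * β)) := by
    intro i
    refine (h.integral_powWeight_le (by positivity) hβ _).trans ?_
    rw [mul_assoc]
    refine mul_le_mul_of_nonneg_left ?_ two_pos.le
    -- The factor `max 1 t`, at least one, absorbs the time, including `t = 0`, and leaves a bound
    -- in `r` alone.
    refine (min_rpow_mono (by positivity) (NNReal.coe_nonneg _) ?_).trans
      (min_rpow_mul_le hβ (le_max_left _ _) hr.le)
    rw [one_mul, NNReal.coe_mul, Real.coe_toNNReal _ hr.le, mul_comm]
    gcongr
    exact le_max_right _ _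
  have hint : ∀ i, Integrable (fun ω => powWeight (2 * β) (N (r.toNNReal * t i) ω)) P :=
    fun i => h.integrable_powWeight hβ _
  calc ∫ ω, ((fun ω => ∑ i, θ i * a (N (r.toNNReal * t i) ω)) ^ 2) ω ∂P
      ≤ ∫ ω, (C ^ 2 * ∑ i, θ i ^ 2) * ∑ i, powWeight (2 * β) (N (r.toNNReal * t i) ω) ∂P :=
        integral_mono hA.integrable_sq
          ((integrable_finsetSum _ fun i _ => hint i).const_mul _) fun ω => sq_sum_mul_le ha θ _
    _ = (C ^ 2 * ∑ i, θ i ^ 2) * ∑ i, ∫ ω, powWeight (2 * β) (N (r.toNNReal * t i) ω) ∂P := by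
        rw [integral_const_mul, integral_finsetSum _ fun i _ => hint i]
    _ ≤ (C ^ 2 * ∑ i, θ i ^ 2) * ∑ i, 2 * max 1 (t i : ℝ) * min r (r ^ (2 * β)) := by
        gcongr with i
        exact hterm i
    _ = _ := by rw [← Finset.sum_mul]; ring

variable {α : ℝ}

lemma integral_intensity [IsProbabilityMeasure P] (hα : 0 < α) {g : ℝ × Ω → ℝ}
    (hg : Integrable g (intensity α P)) :
    ∫ x, g x ∂(intensity α P) =
      ∫ r in Set.Ioi (0 : ℝ), (α * r ^ (-α - 1)) * ∫ ω, g (r, ω) ∂P := by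
  unfold intensity at hg ⊢
  rw [integral_prod _ hg, integral_withDensity_eq_integral_toReal_smul (by fun_prop)
    (ae_of_all _ fun _ => ENNReal.ofReal_lt_top)]
  refine setIntegral_congr_fun measurableSet_Ioi fun r hr => ?_
  have hr' : (0 : ℝ) < r := hr
  simp only [smul_eq_mul]
  rw [ENNReal.toReal_ofReal (by positivity)]

lemma IsPoissonProcess.aestronglyMeasurable_kernelZ (h : IsPoissonProcess N 1 P) (t : ℝ≥0) :
    AEStronglyMeasurable (kernelZ a N P t) (intensity α P) := by
  have := h.isProbabilityMeasure
  have h1 : AEMeasurable (fun x : ℝ × Ω => a (N (x.1.toNNReal * t) x.2)) (intensity α P) :=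
    (measurable_of_countable a).comp_aemeasurable
      (h.aemeasurable_uncurry (q := fun r : ℝ => r.toNNReal * t) (by fun_prop))
  have h2 : AEStronglyMeasurable (fun r : ℝ => ∫ ω, a (N (r.toNNReal * t) ω) ∂P)
      (((volume : Measure ℝ).restrict (Set.Ioi 0)).withDensity
        (fun r => ENNReal.ofReal (α * r ^ (-α - 1)))) :=
    h1.aestronglyMeasurable.integral_prod_right'
  exact h1.aestronglyMeasurable.sub
    (h2.comp_quasiMeasurePreserving Measure.quasiMeasurePreserving_fst)

/-- The integrand of the limit process is square integrable. -/
lemma IsPoissonProcess.memLp_kernelZ (h : IsPoissonProcess N 1 P) (hα : α ∈ Set.Ioo (0 : ℝ) 1)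
    (hβ : β ∈ Set.Ico 0 (α / 2)) (ha : ∀ k, |a k| ≤ C * powWeight β k) (t : ℝ≥0) :
    MemLp (kernelZ a N P t) 2 (intensity α P) := by
  have := h.isProbabilityMeasure
  have hm := h.aestronglyMeasurable_kernelZ (a := a) (α := α) t
  have hβ1 : 2 * β ≤ 1 := by linarith [hβ.2, hα.2]
  rw [memLp_two_iff_integrable_sq hm]
  have hms : AEStronglyMeasurable (fun x => kernelZ a N P t x ^ 2) (intensity α P) := hm.pow 2
  unfold intensity at hms ⊢
  rw [integrable_prod_iff hms]
  constructor
  · refine ae_of_all _ fun r => ?_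
    exact ((h.memLp_two hβ1 ha (r.toNNReal * t)).sub
      (memLp_const (∫ ω, a (N (r.toNNReal * t) ω) ∂P))).integrable_sq
  · have hms' := hms.norm.integral_prod_right'
    -- The density is positive on `(0, ∞)`, so almost everywhere measurability passes from the
    -- weighted measure back to Lebesgue measure.
    have hac := withDensity_absolutelyContinuous' (μ := (volume : Measure ℝ).restrict (Set.Ioi 0))
      (f := fun r : ℝ => ENNReal.ofReal (α * r ^ (-α - 1))) (by fun_prop)
      ((ae_restrict_iff' measurableSet_Ioi).2 (ae_of_all _ fun r hr => by
        have hr' : (0 : ℝ) < r := hr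
        have := hα.1
        simp only [ne_eq, ENNReal.ofReal_eq_zero, not_le]
        positivity))
    rw [integrable_withDensity_iff_integrable_smul' (by fun_prop)
      (ae_of_all _ fun _ => ENNReal.ofReal_lt_top)]
    set K := ((C ^ 2 * ∑ _i : Unit, (1 : ℝ) ^ 2) * ∑ _i : Unit, 2 * max 1 (t : ℝ))
    refine ((integrableOn_rpow_mul_min hα (γ := 2 * β) (by linarith [hβ.2])).const_mul K).mono'
      ((by fun_prop : Measurable fun r : ℝ =>
        (ENNReal.ofReal (α * r ^ (-α - 1))).toReal).aestronglyMeasurable.smul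
          (hms'.mono_ac hac)) ?_
    refine (ae_restrict_iff' measurableSet_Ioi).2 (ae_of_all _ fun r hr => ?_)
    have hr' : (0 : ℝ) < r := hr
    have hα0 := hα.1
    have h3 := h.integral_sq_sum_kernelZ_le hβ.1 hβ1 ha (d := Unit) (fun _ => 1) (fun _ => t) hr'
    have h4 : 0 ≤ ∫ ω, kernelZ a N P t (r, ω) ^ 2 ∂P := integral_nonneg fun _ => sq_nonneg _
    simp only [norm_pow, Real.norm_eq_abs, sq_abs, smul_eq_mul]
    rw [ENNReal.toReal_ofReal (by positivity), abs_of_nonneg (by positivity)]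
    simp only [Finset.univ_unique, Finset.sum_singleton, one_mul] at h3
    calc α * r ^ (-α - 1) * ∫ ω, kernelZ a N P t (r, ω) ^ 2 ∂P
        ≤ α * r ^ (-α - 1) * (K * min r (r ^ (2 * β))) := by
          gcongr
          simpa [K] using h3
      _ = _ := by ring

end Integrand

/-! ### Convergence and agreement of the two series -/

section Series

variable {Ω : Type*} [MeasurableSpace Ω] {P : Measure Ω}

lemma hasSum_mul_measureReal {X : Ω → ℕ} (hX : Measurable X) {g : ℕ → ℝ} (hg0 : g 0 = 0)
    (hg : Integrable (fun ω => g (X ω)) P) :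
    HasSum (fun j : ℕ => g (j + 1) * P.real (X ⁻¹' {j + 1})) (∫ ω, g (X ω) ∂P) := by
  have hms : ∀ k, MeasurableSet (X ⁻¹' {k}) := fun k => hX (measurableSet_singleton k)
  have hU : ⋃ k, X ⁻¹' {k} = Set.univ := by
    ext ω
    simp
  have h := hasSum_integral_iUnion (μ := P) (f := fun ω => g (X ω)) hms
    (fun i j hij => Disjoint.preimage X (by simpa using hij)) hg.integrableOn
  rw [hU, setIntegral_univ] at h
  have h2 : ∀ k, ∫ ω in X ⁻¹' {k}, g (X ω) ∂P = g k * P.real (X ⁻¹' {k}) := by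
    intro k
    rw [setIntegral_congr_fun (g := fun _ => g k) (hms k)
      (fun ω hω => congrArg g (Set.mem_singleton_iff.1 hω)), setIntegral_const, smul_eq_mul, mul_comm]
  simp_rw [h2] at h
  rw [← hasSum_nat_add_iff' 1] at h
  simpa [hg0] using h

/-- The expected total number of balls is finite, so the total is almost surely finite; each
nonempty urn contributes at least one. -/
lemma ae_finite_ne_zero {X : ℕ → Ω → ℕ} (hXi : ∀ l, Integrable (fun ω => (X l ω : ℝ)) P)
    (hXs : Summable fun l => ∫ ω, (X l ω : ℝ) ∂P) :
    ∀ᵐ ω ∂P, {l | X l ω ≠ 0}.Finite := by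
  have h1 : ∑' l, ∫⁻ ω, ‖(X l ω : ℝ)‖ₑ ∂P ≠ ∞ := by
    have h2 : ∀ l, ∫⁻ ω, ‖(X l ω : ℝ)‖ₑ ∂P = ENNReal.ofReal (∫ ω, (X l ω : ℝ) ∂P) := by
      intro l
      rw [ofReal_integral_eq_lintegral_ofReal (hXi l) (ae_of_all _ fun ω => Nat.cast_nonneg _)]
      exact lintegral_congr fun ω => Real.enorm_eq_ofReal (Nat.cast_nonneg _)
    simp_rw [h2]
    exact hXs.tsum_ofReal_ne_top
  rw [← lintegral_tsum fun l => (hXi l).1.enorm] at h1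
  have h3 := ae_lt_top' (AEMeasurable.tsum fun l => (hXi l).1.enorm) h1
  filter_upwards [h3] with ω hω
  have h4 := ENNReal.tendsto_cofinite_zero_of_tsum_ne_top hω.ne
  have h5 := Filter.eventually_cofinite.1 (h4.eventually_lt_const one_pos)
  refine h5.subset fun l hl => ?_
  have : (1 : ℝ) ≤ X l ω := by exact_mod_cast Nat.one_le_iff_ne_zero.2 hl
  simp only [Set.mem_ofPred_eq, not_lt]
  rw [Real.enorm_eq_ofReal (Nat.cast_nonneg _), ← ENNReal.ofReal_one]
  exact ENNReal.ofReal_le_ofReal this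

/-- The double array indexed by urn and count has finite support, so it may be summed in either
order. Empty urns drop out because `a 0 = 0`. -/
lemma hasSum_occupation_counts {Ω : Type*} {X : ℕ → Ω → ℕ} {a : ℕ → ℝ} (ha₀ : a 0 = 0) {ω : Ω}
    (hω : {l | X l ω ≠ 0}.Finite) :
    ∃ S, HasSum (fun j : ℕ => a (j + 1) * ∑' l, if X l ω = j + 1 then (1 : ℝ) else 0) S ∧
      HasSum (fun l => a (X l ω)) S := by
  set F : ℕ × ℕ → ℝ := fun x => a (x.2 + 1) * if X x.1 ω = x.2 + 1 then (1 : ℝ) else 0 with hF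
  have hfin : F.support.Finite := by
    refine (hω.image fun l => (l, X l ω - 1)).subset fun x hx => ?_
    have h1 : X x.1 ω = x.2 + 1 := by
      by_contra h
      simp [hF, h] at hx
    exact ⟨x.1, by simp [h1], by simp [h1]⟩
  have hsum : Summable F := summable_of_hasFiniteSupport hfin
  refine ⟨∑' x, F x, ?_, ?_⟩
  · have h1 := hsum.hasSum
    rw [← (Equiv.prodComm ℕ ℕ).hasSum_iff] at h1
    refine h1.prod_fiberwise fun j => ?_
    refine HasSum.mul_left _ ?_
    refine (summable_of_hasFiniteSupport (hω.subset fun l hl => ?_)).hasSum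
    have : X l ω = j + 1 := by
      by_contra h
      simp [h] at hl
    simp [this]
  · refine hsum.hasSum.prod_fiberwise fun l => ?_
    rcases Nat.eq_zero_or_pos (X l ω) with h | h
    · simp only [hF, h, ha₀]
      simp
    · have h2 := hasSum_single (f := fun j => F (l, j)) (X l ω - 1) (fun j hj => by
        have : X l ω ≠ j + 1 := by omega
        simp [hF, this])
      have h3 : F (l, X l ω - 1) = a (X l ω) := by
        simp only [hF]
        rw [Nat.sub_add_cancel h]
        simp
      rwa [h3] at h2

variable [IsProbabilityMeasure P]

/-- In expectation infinitely many urns contribute, so the exchange of sums rests on absolute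
summability, from `E|a(X_l)| ≤ C E X_l`. -/
lemma hasSum_expected_occupation_counts {X : ℕ → Ω → ℕ} (hX : ∀ l, Measurable (X l))
    (hXi : ∀ l, Integrable (fun ω => (X l ω : ℝ)) P)
    (hXs : Summable fun l => ∫ ω, (X l ω : ℝ) ∂P) {a : ℕ → ℝ} (ha₀ : a 0 = 0) {C : ℝ}
    (ha : ∀ k, |a k| ≤ C * k) :
    ∃ S, HasSum (fun j : ℕ => a (j + 1) *
        ∫ ω, ∑' l, (if X l ω = j + 1 then (1 : ℝ) else 0) ∂P) S ∧
      HasSum (fun l => ∫ ω, a (X l ω) ∂P) S := by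
  have hai : ∀ l, Integrable (fun ω => a (X l ω)) P := fun l =>
    ((hXi l).const_mul C).mono' ((measurable_of_countable a).comp (hX l)).aestronglyMeasurable
      (ae_of_all _ fun ω => ha _)
  set F : ℕ × ℕ → ℝ := fun x => a (x.2 + 1) * P.real (X x.1 ⁻¹' {x.2 + 1}) with hF
  have hnorm : ∀ l, HasSum (fun j => ‖F (l, j)‖) (∫ ω, |a (X l ω)| ∂P) := by
    intro l
    have := hasSum_mul_measureReal (hX l) (g := fun k => |a k|) (by simp [ha₀]) (hai l).abs
    simpa [hF, abs_mul, abs_of_nonneg measureReal_nonneg] using this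
  have hsum : Summable F := by
    refine Summable.of_norm ((summable_prod_of_nonneg fun _ => norm_nonneg _).2
      ⟨fun l => (hnorm l).summable, ?_⟩)
    simp_rw [fun l => (hnorm l).tsum_eq]
    refine Summable.of_nonneg_of_le (fun l => integral_nonneg fun _ => abs_nonneg _) (fun l => ?_)
      (hXs.mul_left C)
    rw [← integral_const_mul]
    exact integral_mono (hai l).abs ((hXi l).const_mul C) fun ω => ha _
  refine ⟨∑' x, F x, ?_, hsum.hasSum.prod_fiberwise fun l =>
    hasSum_mul_measureReal (hX l) ha₀ (hai l)⟩
  have h1 := hsum.hasSum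
  rw [← (Equiv.prodComm ℕ ℕ).hasSum_iff] at h1
  refine h1.prod_fiberwise fun j => HasSum.mul_left _ ?_
  have hind : ∀ l, (fun ω => if X l ω = j + 1 then (1 : ℝ) else 0) =
      (X l ⁻¹' {j + 1}).indicator 1 := by
    intro l
    funext ω
    simp [Set.indicator]
  have hms : ∀ l, MeasurableSet (X l ⁻¹' {j + 1}) := fun l => hX l (measurableSet_singleton _)
  have hint : ∀ l, Integrable (fun ω => if X l ω = j + 1 then (1 : ℝ) else 0) P := by
    intro l
    rw [hind]
    exact (integrable_indicator_iff (hms l)).2 (integrable_const (1 : ℝ)).integrableOn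
  have hval : ∀ l, ∫ ω, (if X l ω = j + 1 then (1 : ℝ) else 0) ∂P = P.real (X l ⁻¹' {j + 1}) := by
    intro l
    rw [hind, integral_indicator_one (hms l)]
  have hs : Summable fun l => ∫ ω, ‖if X l ω = j + 1 then (1 : ℝ) else 0‖ ∂P := by
    refine Summable.of_nonneg_of_le (fun l => integral_nonneg fun _ => norm_nonneg _) (fun l => ?_)
      hXs
    refine integral_mono (hint l).norm (hXi l) fun ω => ?_
    dsimp only
    split_ifs with h
    · simp [h]
    · simp
  have := hasSum_integral_of_summable_integral_norm hint hs
  simp_rw [hval] at this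
  exact this

variable {p : ℕ → ℝ} {N : ℕ → ℝ≥0 → Ω → ℕ} {a : ℕ → ℝ} {β C : ℝ}

/-- Both series for the Poissonized process converge almost surely, and they agree. -/
lemma ae_hasSum_poissonizedW (hp_sum : Summable p) (hp0 : ∀ l, 0 ≤ p l)
    (hN : ∀ l, IsPoissonProcess (N l) (p l).toNNReal P) (ha₀ : a 0 = 0) (hβ : 2 * β ≤ 1)
    (ha : ∀ k, |a k| ≤ C * powWeight β k) (n : ℕ) (t : ℝ≥0) :
    ∀ᵐ ω ∂P, Summable (fun j : ℕ => a (j + 1) * (occupancy N (n * t) (j + 1) ω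
        - ∫ ω', occupancy N (n * t) (j + 1) ω' ∂P)) ∧
      HasSum (fun l : ℕ => a (N l (n * t) ω) - ∫ ω', a (N l (n * t) ω') ∂P)
        (poissonizedW a N P n t ω) := by
  set s : ℝ≥0 := n * t with hs
  have hC : 0 ≤ C := by
    have := (abs_nonneg _).trans (ha 1)
    simpa [powWeight] using this
  have hXi : ∀ l, Integrable (fun ω => (N l s ω : ℝ)) P := fun l => (hN l).integrable s
  have hXs : Summable fun l => ∫ ω, (N l s ω : ℝ) ∂P := by
    simp_rw [fun l => (hN l).integral_eq s, fun l => Real.coe_toNNReal _ (hp0 l)]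
    exact hp_sum.mul_right _
  have ha' : ∀ k, |a k| ≤ C * k := fun k => (ha k).trans
    (mul_le_mul_of_nonneg_left (powWeight_le (by linarith) k) hC)
  obtain ⟨S₂, h1, h2⟩ := hasSum_expected_occupation_counts (X := fun l => N l s)
    (fun l => (hN l).measurable s) hXi hXs ha₀ ha'
  filter_upwards [ae_finite_ne_zero hXi hXs] with ω hω
  obtain ⟨S₁, h3, h4⟩ := hasSum_occupation_counts (X := fun l => N l s) ha₀ hω
  have h5 : HasSum (fun j : ℕ => a (j + 1) * (occupancy N s (j + 1) ω
      - ∫ ω', occupancy N s (j + 1) ω' ∂P)) (S₁ - S₂) := by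
    simp_rw [mul_sub]
    exact h3.sub h1
  refine ⟨h5.summable, ?_⟩
  have h6 : poissonizedW a N P n t ω = S₁ - S₂ := h5.tsum_eq
  rw [h6]
  exact h4.sub h2

end Series

/-! ### Taylor bounds and products of characteristic functions -/

section CharacteristicFunctions

/-- The quadratic bound is global, with `2 + |x| ≤ 3 x²` for `|x| > 1`, so second moments alone
provide domination. -/
lemma norm_exp_I_mul_sub_one_sub_le (x : ℝ) :
    ‖Complex.exp (Complex.I * x) - 1 - Complex.I * x‖ ≤ 3 * x ^ 2 := by
  have hn : ‖Complex.I * (x : ℂ)‖ = |x| := by simp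
  rcases le_or_gt |x| 1 with h | h
  · have := Complex.norm_exp_sub_one_sub_id_le (x := Complex.I * x) (by rwa [hn])
    rw [hn, sq_abs] at this
    nlinarith [sq_nonneg x]
  · calc ‖Complex.exp (Complex.I * x) - 1 - Complex.I * x‖
        ≤ ‖Complex.exp (Complex.I * x)‖ + ‖(1 : ℂ)‖ + ‖Complex.I * (x : ℂ)‖ :=
          (norm_sub_le _ _).trans (by gcongr; exact norm_sub_le _ _)
      _ = 2 + |x| := by rw [Complex.norm_exp_I_mul_ofReal, norm_one, hn]; norm_num
      _ ≤ 3 * x ^ 2 := by rw [← sq_abs x]; nlinarith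

/-- Multiplied by `s²`, the third-order Taylor remainder at `y / s` is at most `y² |y / s|`, which
tends to `0`. -/
lemma tendsto_sq_mul_exp_sub {s y : ℕ → ℝ} {y' : ℝ} (hs : Tendsto s atTop atTop)
    (hy : Tendsto y atTop (𝓝 y')) :
    Tendsto (fun n => ((s n : ℂ)) ^ 2 * (Complex.exp (Complex.I * (y n / s n : ℝ)) - 1 -
      Complex.I * (y n / s n : ℝ))) atTop (𝓝 (-(y' : ℂ) ^ 2 / 2)) := by
  have hz : Tendsto (fun n => y n / s n) atTop (𝓝 0) := hy.div_atTop hs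
  have hmain : Tendsto (fun n => -((y n : ℝ) : ℂ) ^ 2 / 2) atTop (𝓝 (-(y' : ℂ) ^ 2 / 2)) := by
    have hc : Continuous fun x : ℝ => -(x : ℂ) ^ 2 / 2 := by fun_prop
    exact (hc.tendsto _).comp hy
  have herr : Tendsto (fun n => ((s n : ℂ)) ^ 2 * (Complex.exp (Complex.I * (y n / s n : ℝ)) - 1 -
      Complex.I * (y n / s n : ℝ)) - -((y n : ℝ) : ℂ) ^ 2 / 2) atTop (𝓝 0) := by
    have hb : Tendsto (fun n => y n ^ 2 * |y n / s n|) atTop (𝓝 0) := by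
      simpa using (hy.pow 2).mul hz.abs
    refine squeeze_zero_norm' ?_ hb
    have hev : ∀ᶠ n in atTop, |y n / s n| < 1 := by
      have := hz.abs
      rw [abs_zero] at this
      exact this.eventually_lt_const one_pos
    filter_upwards [hev, hs.eventually_gt_atTop 0] with n h1 h2
    have hn : ‖Complex.I * ((y n / s n : ℝ) : ℂ)‖ = |y n / s n| := by
      rw [norm_mul, Complex.norm_I, one_mul, Complex.norm_real, Real.norm_eq_abs]
    have hexp := Complex.exp_bound (x := Complex.I * ((y n / s n : ℝ) : ℂ)) (by rw [hn]; exact h1.le)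
      (n := 3) (by norm_num)
    rw [hn] at hexp
    simp only [Finset.sum_range_succ, Finset.sum_range_zero, pow_zero, Nat.factorial, pow_one,
      zero_add, Nat.cast_one, div_one, mul_one, mul_pow, Complex.I_sq] at hexp
    have hs0 : ((s n : ℝ) : ℂ) ≠ 0 := by exact_mod_cast h2.ne'
    have hs0' : s n ≠ 0 := h2.ne'
    have heq : ((s n : ℂ)) ^ 2 * (Complex.exp (Complex.I * (y n / s n : ℝ)) - 1 -
        Complex.I * (y n / s n : ℝ)) - -((y n : ℝ) : ℂ) ^ 2 / 2 =
        (s n : ℂ) ^ 2 * (Complex.exp (Complex.I * (y n / s n : ℝ)) -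
          (1 + Complex.I * (y n / s n : ℝ) + -1 * ((y n / s n : ℝ) : ℂ) ^ 2 / 2)) := by
      push_cast
      field_simp
      ring
    rw [heq, norm_mul, norm_pow, Complex.norm_real, Real.norm_of_nonneg h2.le]
    calc s n ^ 2 * _ ≤ s n ^ 2 * (|y n / s n| ^ 3 * 1) := by
          gcongr
          refine le_trans ?_ (hexp.trans ?_)
          · norm_num
          · gcongr
            norm_num
      _ = y n ^ 2 * |y n / s n| := by
          have h3 : |y n / s n| ^ 3 = (y n / s n) ^ 2 * |y n / s n| := by rw [pow_succ, sq_abs]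
          rw [h3, div_pow, mul_one, ← mul_assoc, mul_div_cancel₀ _ (pow_ne_zero 2 hs0')]
  simpa using herr.add hmain

lemma norm_prod_sub_prod_le_sum {ι : Type*} (s : Finset ι) {z w : ι → ℂ} (hz : ∀ i, ‖z i‖ ≤ 1)
    (hw : ∀ i, ‖w i‖ ≤ 1) : ‖∏ i ∈ s, z i - ∏ i ∈ s, w i‖ ≤ ∑ i ∈ s, ‖z i - w i‖ := by
  classical
  induction s using Finset.induction_on with
  | empty => simp
  | insert i s hi ih =>
    rw [Finset.prod_insert hi, Finset.prod_insert hi, Finset.sum_insert hi]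
    have h1 : z i * ∏ i ∈ s, z i - w i * ∏ i ∈ s, w i =
        (z i - w i) * ∏ i ∈ s, z i + w i * (∏ i ∈ s, z i - ∏ i ∈ s, w i) := by ring
    rw [h1]
    have h2 : ‖∏ i ∈ s, z i‖ ≤ 1 := by
      rw [norm_prod]
      exact Finset.prod_le_one (fun _ _ => norm_nonneg _) fun i _ => hz i
    calc _ ≤ ‖(z i - w i) * ∏ i ∈ s, z i‖ + ‖w i * (∏ i ∈ s, z i - ∏ i ∈ s, w i)‖ :=
          norm_add_le _ _
      _ ≤ ‖z i - w i‖ * 1 + 1 * ‖∏ i ∈ s, z i - ∏ i ∈ s, w i‖ := by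
          rw [norm_mul, norm_mul]
          gcongr
          exact hw i
      _ ≤ _ := by rw [mul_one, one_mul]; gcongr

lemma norm_exp_sub_one_le_one {z : ℂ} (hz : ‖z‖ ≤ 1) : ‖Complex.exp (z - 1)‖ ≤ 1 := by
  rw [Complex.norm_exp, Real.exp_le_one_iff]
  have := (Complex.re_le_norm z).trans hz
  simp only [Complex.sub_re, Complex.one_re]
  linarith

/-- With `w = z - 1`, `1 + w` and `exp w` agree to first order; when `|w| > 1` the trivial bound `2`
is enough. -/
lemma norm_sub_exp_sub_one_le {z : ℂ} (hz : ‖z‖ ≤ 1) :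
    ‖z - Complex.exp (z - 1)‖ ≤ 2 * ‖z - 1‖ ^ 2 := by
  rcases le_or_gt ‖z - 1‖ 1 with h | h
  · have h1 := Complex.norm_exp_sub_one_sub_id_le h
    have h2 : Complex.exp (z - 1) - 1 - (z - 1) = -(z - Complex.exp (z - 1)) := by ring
    rw [h2, norm_neg] at h1
    nlinarith [sq_nonneg ‖z - 1‖]
  · calc _ ≤ ‖z‖ + ‖Complex.exp (z - 1)‖ := norm_sub_le _ _
      _ ≤ 1 + 1 := add_le_add hz (norm_exp_sub_one_le_one hz)
      _ ≤ _ := by nlinarith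

variable {Ω : Type*} [MeasurableSpace Ω] {P : Measure Ω} [IsProbabilityMeasure P]

lemma norm_integral_exp_I_mul_le_one (X : Ω → ℝ) :
    ‖∫ ω, Complex.exp (Complex.I * X ω) ∂P‖ ≤ 1 := by
  calc _ ≤ ∫ ω, ‖Complex.exp (Complex.I * X ω)‖ ∂P := norm_integral_le_integral_norm _
    _ = 1 := by simp [Complex.norm_exp_I_mul_ofReal]

omit [IsProbabilityMeasure P] in
lemma integral_exp_I_mul_sum {X : ℕ → Ω → ℝ} (hX : ∀ l, Measurable (X l)) (hind : iIndepFun X P)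
    (s : Finset ℕ) :
    ∫ ω, Complex.exp (Complex.I * (∑ l ∈ s, X l ω : ℝ)) ∂P =
      ∏ l ∈ s, ∫ ω, Complex.exp (Complex.I * X l ω) ∂P := by
  have h := congrFun (iIndepFun.charFun_map_fun_finsetSum_eq_prod (s := s)
    (fun l _ => (hX l).aemeasurable (μ := P)) (hind.restrict s)) 1
  rw [Finset.prod_apply, charFun_apply_real, integral_map
    (Finset.aemeasurable_fun_sum _ fun l _ => (hX l).aemeasurable) (by fun_prop)] at h
  simp_rw [charFun_apply_real, fun l => integral_map (hX l).aemeasurable (μ := P)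
    (f := fun x : ℝ => Complex.exp ((1 : ℝ) * x * Complex.I)) (by fun_prop)] at h
  simpa [mul_comm] using h

/-- The characteristic function of a sum of independent variables is close to that of its
accompanying compound Poisson law. -/
lemma norm_integral_exp_hasSum_sub_le {X : ℕ → Ω → ℝ} {S : Ω → ℝ} (hX : ∀ l, Measurable (X l))
    (hind : iIndepFun X P) (hS : ∀ᵐ ω ∂P, HasSum (fun l => X l ω) (S ω)) {z : ℕ → ℂ}
    (hz : ∀ l, ∫ ω, Complex.exp (Complex.I * X l ω) ∂P = z l) (hz1 : Summable fun l => z l - 1)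
    (hz2 : Summable fun l => ‖z l - 1‖ ^ 2) :
    ‖∫ ω, Complex.exp (Complex.I * S ω) ∂P - Complex.exp (∑' l, (z l - 1))‖ ≤
      2 * ∑' l, ‖z l - 1‖ ^ 2 := by
  have hzn : ∀ l, ‖z l‖ ≤ 1 := fun l => hz l ▸ norm_integral_exp_I_mul_le_one _
  -- The comparison is made for finitely many factors, with a bound independent of `L`, and then
  -- passed to the limit.
  have hlim1 : Tendsto
      (fun L => ∫ ω, Complex.exp (Complex.I * (∑ l ∈ Finset.range L, X l ω : ℝ)) ∂P) atTop
      (𝓝 (∫ ω, Complex.exp (Complex.I * S ω) ∂P)) := by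
    have hc : Continuous fun x : ℝ => Complex.exp (Complex.I * x) := by fun_prop
    refine tendsto_integral_of_dominated_convergence (fun _ => (1 : ℝ)) (fun L => ?_)
      (integrable_const _) (fun L => ae_of_all _ fun ω => ?_) ?_
    · exact (hc.measurable.comp
        (Finset.measurable_fun_sum _ fun l _ => hX l)).aestronglyMeasurable
    · rw [Complex.norm_exp_I_mul_ofReal]
    · filter_upwards [hS] with ω hω
      exact (hc.tendsto _).comp hω.tendsto_sum_nat
  have hlim2 : Tendsto (fun L => ∏ l ∈ Finset.range L, Complex.exp (z l - 1)) atTop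
      (𝓝 (Complex.exp (∑' l, (z l - 1)))) := by
    simp_rw [← Complex.exp_sum]
    exact (Complex.continuous_exp.tendsto _).comp hz1.hasSum.tendsto_sum_nat
  refine le_of_tendsto (hlim1.sub hlim2).norm (Eventually.of_forall fun L => ?_)
  rw [integral_exp_I_mul_sum hX hind]
  simp_rw [hz]
  calc _ ≤ ∑ l ∈ Finset.range L, ‖z l - Complex.exp (z l - 1)‖ :=
        norm_prod_sub_prod_le_sum _ hzn fun l => norm_exp_sub_one_le_one (hzn l)
    _ ≤ ∑ l ∈ Finset.range L, 2 * ‖z l - 1‖ ^ 2 :=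
        Finset.sum_le_sum fun l _ => norm_sub_exp_sub_one_le (hzn l)
    _ = 2 * ∑ l ∈ Finset.range L, ‖z l - 1‖ ^ 2 := by rw [Finset.mul_sum]
    _ ≤ _ := by
        gcongr
        exact hz2.sum_le_tsum _ fun _ _ => sq_nonneg _

end CharacteristicFunctions

/-! ### The contribution of a single urn -/

section LocalLimit

variable {Ω : Type*} [MeasurableSpace Ω] {P : Measure Ω} {N : ℝ≥0 → Ω → ℕ}
  {a : ℕ → ℝ} {β C : ℝ} {d : Type*} [Fintype d]

/-- The characteristic function, at scale `s`, of the contribution of a single urn with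
expected number of balls `r`. -/
noncomputable def urnCharFun (a : ℕ → ℝ) (N : ℝ≥0 → Ω → ℕ) (P : Measure Ω) (θ : d → ℝ)
    (t : d → ℝ≥0) (s r : ℝ) : ℂ :=
  ∫ ω, Complex.exp (Complex.I * ((∑ i, θ i * kernelZ a N P (t i) (r, ω)) / s : ℝ)) ∂P

lemma IsPoissonProcess.memLp_two_sum_kernelZ (h : IsPoissonProcess N 1 P) (hβ : 2 * β ≤ 1)
    (ha : ∀ k, |a k| ≤ C * powWeight β k) (θ : d → ℝ) (t : d → ℝ≥0) (r : ℝ) :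
    MemLp (fun ω => ∑ i, θ i * kernelZ a N P (t i) (r, ω)) 2 P := by
  have := h.isProbabilityMeasure
  simp_rw [h.sum_kernelZ_eq hβ ha]
  exact (h.memLp_two_sum hβ ha θ _).sub (memLp_const _)

/-- The linear term has mean zero because the kernel is centered. Subtracting it leaves an integrand
of second order. -/
lemma IsPoissonProcess.sq_mul_urnCharFun_sub_one (h : IsPoissonProcess N 1 P) (hβ : 2 * β ≤ 1)
    (ha : ∀ k, |a k| ≤ C * powWeight β k) (θ : d → ℝ) (t : d → ℝ≥0) (s r : ℝ) :
    (s : ℂ) ^ 2 * (urnCharFun a N P θ t s r - 1) =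
      ∫ ω, (s : ℂ) ^ 2 * (Complex.exp (Complex.I *
        ((∑ i, θ i * kernelZ a N P (t i) (r, ω)) / s : ℝ)) - 1 -
          Complex.I * ((∑ i, θ i * kernelZ a N P (t i) (r, ω)) / s : ℝ)) ∂P := by
  have := h.isProbabilityMeasure
  have hm := h.memLp_two_sum_kernelZ hβ ha θ t r
  have hi : Integrable (fun ω => (∑ i, θ i * kernelZ a N P (t i) (r, ω)) / s) P :=
    (hm.integrable (by norm_num)).div_const s
  have h0 : ∫ ω, (∑ i, θ i * kernelZ a N P (t i) (r, ω)) / s ∂P = 0 := by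
    simp_rw [integral_div, h.sum_kernelZ_eq hβ ha]
    rw [integral_sub ((h.memLp_two_sum hβ ha θ _).integrable (by norm_num)) (integrable_const _)]
    simp
  have he := integrable_exp_I_mul hi.aemeasurable
  have he1 : Integrable (fun ω => Complex.exp (Complex.I *
      ((∑ i, θ i * kernelZ a N P (t i) (r, ω)) / s : ℝ)) - 1) P := he.sub (integrable_const _)
  have he2 : Integrable (fun ω => Complex.I *
      (((∑ i, θ i * kernelZ a N P (t i) (r, ω)) / s : ℝ) : ℂ)) P := hi.ofReal.const_mul _
  rw [integral_const_mul, integral_sub he1 he2,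
    integral_sub he (integrable_const _), integral_const_mul, integral_complex_ofReal, h0]
  simp [urnCharFun]

lemma IsPoissonProcess.norm_sq_mul_urnCharFun_sub_one_le (h : IsPoissonProcess N 1 P) (hβ0 : 0 ≤ β)
    (hβ : 2 * β ≤ 1) (ha : ∀ k, |a k| ≤ C * powWeight β k) (θ : d → ℝ) (t : d → ℝ≥0) (s : ℝ)
    {r : ℝ} (hr : 0 < r) :
    ‖(s : ℂ) ^ 2 * (urnCharFun a N P θ t s r - 1)‖ ≤
      (3 * ((C ^ 2 * ∑ i, θ i ^ 2) * ∑ i, 2 * max 1 (t i : ℝ))) * min r (r ^ (2 * β)) := by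
  rw [h.sq_mul_urnCharFun_sub_one hβ ha, mul_assoc 3]
  refine le_trans ?_ (mul_le_mul_of_nonneg_left
    (h.integral_sq_sum_kernelZ_le hβ0 hβ ha θ t hr) (by norm_num))
  rw [← integral_const_mul]
  refine norm_integral_le_of_norm_le
    ((h.memLp_two_sum_kernelZ hβ ha θ t r).integrable_sq.const_mul 3) (ae_of_all _ fun ω => ?_)
  set y := ∑ i, θ i * kernelZ a N P (t i) (r, ω)
  rw [norm_mul, norm_pow, Complex.norm_real, Real.norm_eq_abs, sq_abs]
  calc s ^ 2 * _ ≤ s ^ 2 * (3 * (y / s) ^ 2) := by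
        gcongr
        exact norm_exp_I_mul_sub_one_sub_le _
    _ ≤ 3 * y ^ 2 := by
        -- The value `s = 0` does occur, since `σ_n = 0` for small `n`; the left side is then `0`.
        by_cases hs : s = 0
        · simp [hs]
          positivity
        · rw [div_pow]
          field_simp
          rfl

/-- Both the path value and its mean `m n` vary with `n`. The means converge, the second-order
expansion holds at each integer vector, and `tendsto_integral_comp` passes to the expectation,
dominated by a linear function of the counts. -/
lemma IsPoissonProcess.tendsto_sq_mul_urnCharFun_sub_one (h : IsPoissonProcess N 1 P)
    (hβ : 2 * β ≤ 1) (ha : ∀ k, |a k| ≤ C * powWeight β k) (θ : d → ℝ) (t : d → ℝ≥0)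
    {s : ℕ → ℝ} (hs : Tendsto s atTop atTop) {q : ℕ → ℝ} {r : ℝ} (hq : Tendsto q atTop (𝓝 r)) :
    Tendsto (fun n => (s n : ℂ) ^ 2 * (urnCharFun a N P θ t (s n) (q n) - 1)) atTop
      (𝓝 (-((∫ ω, (∑ i, θ i * kernelZ a N P (t i) (r, ω)) ^ 2 ∂P : ℝ) : ℂ) / 2)) := by
  have := h.isProbabilityMeasure
  have hq' : Tendsto (fun n => (q n).toNNReal) atTop (𝓝 r.toNNReal) :=
    (continuous_real_toNNReal.tendsto _).comp hq
  set A : (d → ℕ) → ℝ := fun k => ∑ i, θ i * a (k i) with hA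
  set K : ℝ := C ^ 2 * ∑ i, θ i ^ 2 with hK
  have hK0 : 0 ≤ K := by positivity
  have hA2 : ∀ k, A k ^ 2 ≤ K * ∑ i, (k i : ℝ) := fun k => sq_sum_mul_le_sum hβ ha θ k
  have hsum0 : ∀ k : d → ℕ, 0 ≤ ∑ i, (k i : ℝ) := fun k =>
    Finset.sum_nonneg fun _ _ => Nat.cast_nonneg _
  set m : ℕ → ℝ := fun n => ∫ ω, A (fun i => N ((q n).toNNReal * t i) ω) ∂P with hm
  set m' : ℝ := ∫ ω, A (fun i => N (r.toNNReal * t i) ω) ∂P with hm'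
  have hmlim : Tendsto m atTop (𝓝 m') := by
    refine h.tendsto_integral_comp hq' (G := fun _ => A) (K := 1 + K)
      (fun k => tendsto_const_nhds) fun _ k => ?_
    have h1 : |A k| ≤ 1 + A k ^ 2 := by nlinarith [sq_abs (A k), sq_nonneg (|A k| - 1)]
    rw [Real.norm_eq_abs]
    nlinarith [hA2 k, hsum0 k]
  obtain ⟨B, hB⟩ := hmlim.abs.bddAbove_range
  have hmB : ∀ n, m n ^ 2 ≤ B ^ 2 := fun n => by
    rw [← sq_abs (m n)]
    exact pow_le_pow_left₀ (abs_nonneg _) (hB (Set.mem_range_self n)) 2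
  have hlim := h.tendsto_integral_comp (t := t) hq'
    (G := fun n k => (s n : ℂ) ^ 2 * (Complex.exp (Complex.I * ((A k - m n) / s n : ℝ)) - 1 -
      Complex.I * ((A k - m n) / s n : ℝ)))
    (G' := fun k => -((A k - m' : ℝ) : ℂ) ^ 2 / 2) (K := 6 * K + 6 * B ^ 2)
    (fun k => tendsto_sq_mul_exp_sub hs (tendsto_const_nhds.sub hmlim)) ?_
  · simp_rw [h.sq_mul_urnCharFun_sub_one hβ ha, h.sum_kernelZ_eq hβ ha]
    convert! hlim using 2
    have hR : ∀ x : ℝ, -(x : ℂ) ^ 2 / 2 = ((-x ^ 2 / 2 : ℝ) : ℂ) := fun x => by push_cast; ring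
    simp_rw [hR]
    rw [integral_complex_ofReal, integral_div, integral_neg]
    push_cast
    rfl
  · intro n k
    rw [norm_mul, norm_pow, Complex.norm_real, Real.norm_eq_abs, sq_abs]
    calc s n ^ 2 * _ ≤ s n ^ 2 * (3 * ((A k - m n) / s n) ^ 2) := by
          gcongr
          exact norm_exp_I_mul_sub_one_sub_le _
      _ ≤ 3 * (A k - m n) ^ 2 := by
          by_cases hs : s n = 0
          · simp [hs]
            positivity
          · rw [div_pow]
            field_simp
            rfl
      _ ≤ 6 * A k ^ 2 + 6 * m n ^ 2 := by nlinarith [sq_nonneg (A k + m n)]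
      _ ≤ (6 * K + 6 * B ^ 2) * (1 + ∑ i, (k i : ℝ)) := by
          nlinarith [hA2 k, hsum0 k, hmB n, mul_nonneg (sq_nonneg B) (hsum0 k)]

end LocalLimit

/-! ### Summation over the urns -/

section Convergence

variable {Ω Ω' : Type*} [MeasurableSpace Ω] [MeasurableSpace Ω'] {P : Measure Ω} {P' : Measure Ω'}
  {d : ℕ}

lemma IsPoissonProcess.integral_comp_eq_rate_one {N : ℝ≥0 → Ω → ℕ} {N' : ℝ≥0 → Ω' → ℕ} {lam : ℝ≥0}
    (h : IsPoissonProcess N lam P) (h' : IsPoissonProcess N' 1 P') (t : Fin d → ℝ≥0)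
    {F : Type*} [NormedAddCommGroup F] [NormedSpace ℝ F] (g : (Fin d → ℕ) → F) :
    ∫ ω, g (fun i => N (t i) ω) ∂P = ∫ ω, g (fun i => N' (lam * t i) ω) ∂P' := by
  rw [← integral_map (φ := fun ω i => N (t i) ω) (f := g)
      (measurable_pi_lambda _ fun i => h.measurable _).aemeasurable
      StronglyMeasurable.of_discrete.aestronglyMeasurable,
    ← integral_map (φ := fun ω i => N' (lam * t i) ω) (f := g)
      (measurable_pi_lambda _ fun i => h'.measurable _).aemeasurable
      StronglyMeasurable.of_discrete.aestronglyMeasurable, h.map_eq_map_rate_one h']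

lemma IsPoissonProcess.integral_exp_eq_urnCharFun {N : ℝ≥0 → Ω → ℕ} {N' : ℝ≥0 → Ω' → ℕ} {p : ℝ}
    (h : IsPoissonProcess N p.toNNReal P) (h' : IsPoissonProcess N' 1 P')
    (a : ℕ → ℝ) (θ : Fin d → ℝ) (t : Fin d → ℝ≥0) (n : ℕ) (s : ℝ) :
    ∫ ω, Complex.exp (Complex.I *
      ((∑ i, θ i * (a (N (n * t i) ω) - ∫ ω', a (N (n * t i) ω') ∂P)) / s : ℝ)) ∂P =
      urnCharFun a N' P' θ t s (n * p) := by
  have htime : ∀ i, p.toNNReal * (n * t i) = (n * p).toNNReal * t i := fun i => by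
    rw [Real.toNNReal_mul (Nat.cast_nonneg n), Real.toNNReal_natCast]
    ring
  have hc : ∀ i, ∫ ω', a (N (n * t i) ω') ∂P = ∫ ω', a (N' ((n * p).toNNReal * t i) ω') ∂P' := by
    intro i
    have := h.integral_comp_eq_rate_one h' (fun i => n * t i) (fun k => a (k i))
    simpa only [htime] using this
  have := h.integral_comp_eq_rate_one h' (fun i => n * t i) (fun k => Complex.exp (Complex.I *
      ((∑ i, θ i * (a (k i) - ∫ ω', a (N (n * t i) ω') ∂P)) / s : ℝ)))
  rw [this]
  simp_rw [htime, hc]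
  rfl

variable [IsProbabilityMeasure P] [IsProbabilityMeasure P']
  {α : ℝ} (hα : α ∈ Set.Ioo (0 : ℝ) 1)
  {p : ℕ → ℝ} (hpos : ∀ l, 0 < p l) (hsum : Summable p)
  {C₀ : ℝ} (hC₀ : 0 < C₀)
  (hp : Tendsto (fun l : ℕ => p l / (C₀ * ((l : ℝ) + 1) ^ (-(1 / α)))) atTop (𝓝 1))
  {a : ℕ → ℝ} {β C : ℝ} (hβ : β ∈ Set.Ico 0 (α / 2)) (ha : ∀ k, |a k| ≤ C * powWeight β k)
  {N' : ℝ≥0 → Ω' → ℕ} (hN' : IsPoissonProcess N' 1 P')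

include hα hpos hsum hC₀ hp hβ ha hN'

/-- Multiplication of each term by `σ_n² = v(n)` gives functions `c n` to which the normalized limit
theorem applies. These are exactly the inputs of the comparison with the accompanying compound
Poisson law. -/
lemma tendsto_tsum_urnCharFun_sub_one (θ : Fin d → ℝ) (t : Fin d → ℝ≥0) :
    Tendsto (fun n : ℕ => ∑' l, (urnCharFun a N' P' θ t (sigma p n) (n * p l) - 1)) atTop
      (𝓝 (-((∫ x, (∑ i, θ i * kernelZ a N' P' (t i) x) ^ 2 ∂(intensity α P') : ℝ) : ℂ) / 2)) ∧
    Tendsto (fun n : ℕ => ∑' l, ‖urnCharFun a N' P' θ t (sigma p n) (n * p l) - 1‖ ^ 2) atTop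
      (𝓝 0) ∧
    ∀ᶠ n : ℕ in atTop,
      Summable (fun l => urnCharFun a N' P' θ t (sigma p n) (n * p l) - 1) ∧
      Summable (fun l => ‖urnCharFun a N' P' θ t (sigma p n) (n * p l) - 1‖ ^ 2) := by
  have hβ1 : 2 * β ≤ 1 := by linarith [hβ.2, hα.2]
  have hβ0 : 0 ≤ 2 * β := by linarith [hβ.1]
  have hβα : 2 * β < α := by linarith [hβ.2]
  set c : ℕ → ℝ → ℂ := fun n r =>
    ((sigma p n : ℝ) : ℂ) ^ 2 * (urnCharFun a N' P' θ t (sigma p n) r - 1) with hc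
  set K : ℝ := 3 * ((C ^ 2 * ∑ i, θ i ^ 2) * ∑ i, 2 * max 1 (t i : ℝ)) with hK
  have hbound : ∀ n r, 0 < r → ‖c n r‖ ≤ K * min r (r ^ (2 * β)) := fun n r hr =>
    hN'.norm_sq_mul_urnCharFun_sub_one_le hβ.1 hβ1 ha θ t _ hr
  have hK0 : 0 ≤ K := by positivity
  have hv : Tendsto (fun n : ℕ => (urnCount p n : ℝ)) atTop atTop :=
    tendsto_urnCount hα hC₀ hp hpos hsum
  have hσ : Tendsto (fun n : ℕ => sigma p n) atTop atTop := Real.tendsto_sqrt_atTop.comp hv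
  have hσv : ∀ n : ℕ, sigma p n ^ 2 = urnCount p n := fun n => Real.sq_sqrt (Nat.cast_nonneg _)
  have hnc : ∀ (n : ℕ) r, ‖c n r‖ = urnCount p n * ‖urnCharFun a N' P' θ t (sigma p n) r - 1‖ := by
    intro n r
    simp only [hc, norm_mul, norm_pow, Complex.norm_real, Real.norm_eq_abs, sq_abs, hσv]
  have hlim : ∀ (r : ℝ) (s : ℕ → ℝ), Tendsto s atTop (𝓝 r) → Tendsto (fun n => c n (s n)) atTop
      (𝓝 (-((∫ ω, (∑ i, θ i * kernelZ a N' P' (t i) (r, ω)) ^ 2 ∂P' : ℝ) : ℂ) / 2)) :=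
    fun r s hs => hN'.tendsto_sq_mul_urnCharFun_sub_one hβ1 ha θ t hσ hs
  have hcs : ∀ n : ℕ, 0 < n → Summable fun l => ‖c n (n * p l)‖ := by
    intro n hn
    have hn' : (0 : ℝ) < n := by exact_mod_cast hn
    refine Summable.of_nonneg_of_le (fun _ => norm_nonneg _)
      (fun l => (hbound n _ (mul_pos hn' (hpos l))).trans
        (mul_le_mul_of_nonneg_left (min_le_left _ _) hK0)) ?_
    exact (hsum.mul_left (n : ℝ)).mul_left K
  have hz2 : ∀ (n : ℕ) r, ‖urnCharFun a N' P' θ t (sigma p n) r - 1‖ ≤ 2 := by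
    intro n r
    calc _ ≤ ‖urnCharFun a N' P' θ t (sigma p n) r‖ + ‖(1 : ℂ)‖ := norm_sub_le _ _
      _ ≤ 1 + 1 := by
          rw [norm_one]
          gcongr
          exact norm_integral_exp_I_mul_le_one _
      _ = 2 := by norm_num
  have hz : ∀ n : ℕ, (urnCount p n : ℝ) ≠ 0 → ∀ r,
      urnCharFun a N' P' θ t (sigma p n) r - 1 = ((urnCount p n : ℝ)⁻¹ : ℝ) • c n r := by
    intro n hn r
    have h1 : ((sigma p n : ℝ) : ℂ) ^ 2 = ((urnCount p n : ℝ) : ℂ) := by exact_mod_cast hσv n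
    have hn' : ((urnCount p n : ℝ) : ℂ) ≠ 0 := by exact_mod_cast hn
    simp only [hc]
    rw [h1, Complex.real_smul, Complex.ofReal_inv, inv_mul_cancel_left₀ hn']
  have hpos' : ∀ᶠ n : ℕ in atTop, 0 < n ∧ (urnCount p n : ℝ) ≠ 0 := by
    filter_upwards [eventually_gt_atTop 0, hv.eventually_gt_atTop 0] with n h1 h2
    exact ⟨h1, h2.ne'⟩
  refine ⟨?_, ?_, ?_⟩
  · have h1 := tendsto_tsum_frequency_div_urnCount hα hC₀ hp hpos hsum hβ0 hβα hbound
      (fun r s _ _ hs => hlim r s hs)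
    have hmem : MemLp (fun x => ∑ i, θ i * kernelZ a N' P' (t i) x) 2 (intensity α P') :=
      memLp_finsetSum _ fun i _ => (hN'.memLp_kernelZ hα hβ ha (t i)).const_mul (θ i)
    have h2 : ∫ r in Set.Ioi (0 : ℝ), (α * r ^ (-α - 1)) •
        (-((∫ ω, (∑ i, θ i * kernelZ a N' P' (t i) (r, ω)) ^ 2 ∂P' : ℝ) : ℂ) / 2) =
        -((∫ x, (∑ i, θ i * kernelZ a N' P' (t i) x) ^ 2 ∂(intensity α P') : ℝ) : ℂ) / 2 := by
      rw [integral_intensity hα.1 hmem.integrable_sq, ← integral_complex_ofReal, ← integral_neg,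
        ← integral_div]
      congr 1
      funext r
      rw [Complex.real_smul]
      push_cast
      ring
    rw [h2] at h1
    refine h1.congr' ?_
    filter_upwards [hpos'] with n hn
    simp_rw [hz n hn.2]
    exact ((hcs n hn.1).of_norm.tsum_const_smul _).symm
  -- The squared terms are `v(n)⁻²` times `|c n|²`. The function `v(n)⁻¹ |c n|²` tends to `0`
  -- pointwise and is at most `2 |c n|`, whence the constant `2 * K`.
  · have h1 := tendsto_tsum_frequency_div_urnCount hα hC₀ hp hpos hsum hβ0 hβα (K := 2 * K)
      (g := fun n r => (urnCount p n : ℝ)⁻¹ * ‖c n r‖ ^ 2) (g' := fun _ => 0) ?_ ?_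
    · simp only [smul_zero, integral_zero] at h1
      refine h1.congr' ?_
      filter_upwards [hpos'] with n hn
      rw [smul_eq_mul, ← tsum_mul_left]
      refine tsum_congr fun l => ?_
      have := hn.2
      rw [hnc]
      field_simp
    · intro n r hr
      rw [Real.norm_of_nonneg (by positivity)]
      by_cases hn : (urnCount p n : ℝ) = 0
      · rw [hn, inv_zero, zero_mul]
        positivity
      · calc (urnCount p n : ℝ)⁻¹ * ‖c n r‖ ^ 2
            = ‖urnCharFun a N' P' θ t (sigma p n) r - 1‖ * ‖c n r‖ := by
              rw [hnc]
              field_simp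
          _ ≤ 2 * (K * min r (r ^ (2 * β))) :=
              mul_le_mul (hz2 n r) (hbound n r hr) (norm_nonneg _) (by norm_num)
          _ = _ := by ring
    · intro r s _ _ hs
      have := (tendsto_inv_atTop_zero.comp hv).mul ((hlim r s hs).norm.pow 2)
      rwa [zero_mul] at this
  · filter_upwards [hpos'] with n hn
    have h1 : Summable fun l => ‖urnCharFun a N' P' θ t (sigma p n) (n * p l) - 1‖ := by
      simp_rw [hz n hn.2, norm_smul]
      exact (hcs n hn.1).mul_left _
    refine ⟨h1.of_norm, Summable.of_nonneg_of_le (fun _ => sq_nonneg _) (fun l => ?_)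
      (h1.mul_left 2)⟩
    rw [sq]
    exact mul_le_mul_of_nonneg_right (hz2 n _) (norm_nonneg _)

/-- The characteristic functions of the finite-dimensional distributions converge. -/
lemma tendsto_integral_exp_poissonizedW (ha₀ : a 0 = 0) {N : ℕ → ℝ≥0 → Ω → ℕ}
    (hN : ∀ l, IsPoissonProcess (N l) (p l).toNNReal P)
    (hN_indep : iIndepFun (fun l ω => fun t : ℝ≥0 => N l t ω) P)
    (θ : Fin d → ℝ) (t : Fin d → ℝ≥0) :
    Tendsto (fun n : ℕ => ∫ ω, Complex.exp (Complex.I *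
        (∑ i, θ i * (poissonizedW a N P n (t i) ω / sigma p n) : ℝ)) ∂P) atTop
      (𝓝 (Complex.exp
        (-((∫ x, (∑ i, θ i * kernelZ a N' P' (t i) x) ^ 2 ∂(intensity α P') : ℝ) : ℂ) / 2))) := by
  have hβ1 : 2 * β ≤ 1 := by linarith [hβ.2, hα.2]
  obtain ⟨h1, h2, h3⟩ := tendsto_tsum_urnCharFun_sub_one hα hpos hsum hC₀ hp hβ ha hN' θ t
  have h4 := (Complex.continuous_exp.tendsto _).comp h1
  rw [tendsto_iff_norm_sub_tendsto_zero] at h4 ⊢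
  have h5 := (h2.const_mul 2).add h4
  rw [mul_zero, zero_add] at h5
  refine squeeze_zero' (Eventually.of_forall fun _ => norm_nonneg _) ?_ h5
  filter_upwards [h3] with n ⟨hs1, hs2⟩
  refine (norm_sub_le_norm_sub_add_norm_sub _
    (Complex.exp (∑' l, (urnCharFun a N' P' θ t (sigma p n) (n * p l) - 1))) _).trans ?_
  refine add_le_add_left ?_ _
  -- Each contribution is a measurable function of the whole path of one urn, so independence of the
  -- paths carries over.
  have hg : ∀ l, Measurable fun f : ℝ≥0 → ℕ =>
      (∑ i, θ i * (a (f (n * t i)) - ∫ ω', a (N l (n * t i) ω') ∂P)) / sigma p n := fun l =>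
    (Finset.measurable_fun_sum _ fun i _ => (((measurable_of_countable a).comp
      (measurable_pi_apply _)).sub_const _).const_mul _).div_const _
  refine norm_integral_exp_hasSum_sub_le (fun l => (hg l).comp
    (measurable_pi_lambda _ fun s => (hN l).measurable s)) (hN_indep.comp _ hg) ?_
    (fun l => (hN l).integral_exp_eq_urnCharFun hN' a θ t n _) hs1 hs2
  have h6 : ∀ᵐ ω ∂P, ∀ i, HasSum
      (fun l : ℕ => a (N l (n * t i) ω) - ∫ ω', a (N l (n * t i) ω') ∂P)
        (poissonizedW a N P n (t i) ω) := ae_all_iff.2 fun i =>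
    (ae_hasSum_poissonizedW hsum (fun l => (hpos l).le) hN ha₀ hβ1 ha n (t i)).mono
      fun _ h => h.2
  filter_upwards [h6] with ω hω
  have h7 := (hasSum_sum fun i (_ : i ∈ Finset.univ) => (hω i).mul_left (θ i)).div_const (sigma p n)
  convert! h7 using 1
  rw [Finset.sum_div]
  exact Finset.sum_congr rfl fun i _ => by rw [mul_div_assoc]

end Convergence

/-! ### From characteristic functions to convergence in distribution -/

lemma aemeasurable_poissonizedW {Ω : Type*} [MeasurableSpace Ω] {P : Measure Ω}
    {a : ℕ → ℝ} {N : ℕ → ℝ≥0 → Ω → ℕ} {n : ℕ} {t : ℝ≥0} (hN : ∀ l s, Measurable (N l s))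
    (h : ∀ᵐ ω ∂P, HasSum (fun l : ℕ => a (N l (n * t) ω) - ∫ ω', a (N l (n * t) ω') ∂P)
        (poissonizedW a N P n t ω)) :
    AEMeasurable (poissonizedW a N P n t) P := by
  refine aemeasurable_of_tendsto_metrizable_ae atTop (f := fun L ω =>
    ∑ l ∈ Finset.range L, (a (N l (n * t) ω) - ∫ ω', a (N l (n * t) ω') ∂P)) (fun L => ?_)
    (h.mono fun ω hω => hω.tendsto_sum_nat)
  exact (Finset.measurable_fun_sum _ fun l _ =>
    ((measurable_of_countable a).comp (hN l _)).sub_const _).aemeasurable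

lemma charFun_map_toLp {S : Type*} [MeasurableSpace S] {Q : Measure S} {d : ℕ} {Y : Fin d → S → ℝ}
    (hY : AEMeasurable (fun ω => WithLp.toLp 2 fun i => Y i ω) Q) (θ : EuclideanSpace ℝ (Fin d)) :
    charFun (Q.map fun ω => WithLp.toLp 2 fun i => Y i ω) θ =
      ∫ ω, Complex.exp (Complex.I * (∑ i, θ i * Y i ω : ℝ)) ∂Q := by
  rw [charFun_apply, integral_map hY (by fun_prop)]
  simp [PiLp.inner_apply, mul_comm]

/-- The Lévy continuity theorem for random vectors, with the characteristic functions written as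
expectations. -/
lemma tendstoInDistribution_of_tendsto_integral_exp {Ω Ω'' : Type*} [MeasurableSpace Ω]
    [MeasurableSpace Ω''] {P : Measure Ω} [IsProbabilityMeasure P] {P'' : Measure Ω''}
    [IsProbabilityMeasure P''] {d : ℕ} {X : ℕ → Fin d → Ω → ℝ} {Z : Fin d → Ω'' → ℝ}
    (hX : ∀ n i, AEMeasurable (X n i) P) (hZ : ∀ i, AEMeasurable (Z i) P'')
    (h : ∀ θ : Fin d → ℝ, Tendsto
      (fun n => ∫ ω, Complex.exp (Complex.I * (∑ i, θ i * X n i ω : ℝ)) ∂P) atTop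
      (𝓝 (∫ ω, Complex.exp (Complex.I * (∑ i, θ i * Z i ω : ℝ)) ∂P''))) :
    TendstoInDistribution (fun n ω => fun i => X n i ω) atTop (fun ω => fun i => Z i ω)
      (fun _ => P) P'' := by
  have hX' : ∀ n, AEMeasurable (fun ω => WithLp.toLp 2 fun i => X n i ω) P := fun n =>
    (WithLp.measurable_toLp 2 _).comp_aemeasurable (aemeasurable_pi_lambda _ (hX n))
  have hZ' : AEMeasurable (fun ω => WithLp.toLp 2 fun i => Z i ω) P'' :=
    (WithLp.measurable_toLp 2 _).comp_aemeasurable (aemeasurable_pi_lambda _ hZ)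
  -- Characteristic functions use the inner product of Euclidean space; the continuous identity map
  -- returns to the product space.
  have key : TendstoInDistribution (E := EuclideanSpace ℝ (Fin d))
      (fun n ω => WithLp.toLp 2 fun i => X n i ω) atTop (fun ω => WithLp.toLp 2 fun i => Z i ω) (fun _ => P) P'' := by
    refine ⟨hX', hZ', ProbabilityMeasure.tendsto_iff_tendsto_charFun.2 fun θ => ?_⟩
    simp only [ProbabilityMeasure.coe_mk]
    rw [charFun_map_toLp hZ']
    simp_rw [fun n => charFun_map_toLp (hX' n)]
    exact h θ
  exact key.continuous_comp (PiLp.continuous_ofLp 2 _)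

end KarlinModel

/-- The urn labelled `l + 1` has frequency `p l` and Poisson process `N l`. -/
theorem proposition3p2
    {Ω Ω' Ω'' : Type*} [MeasurableSpace Ω] [MeasurableSpace Ω'] [MeasurableSpace Ω'']
    (P : Measure Ω) [IsProbabilityMeasure P]
    (P' : Measure Ω') [IsProbabilityMeasure P']
    (P'' : Measure Ω'') [IsProbabilityMeasure P'']
    (α : ℝ) (hα : α ∈ Set.Ioo (0 : ℝ) 1)
    -- the sampling frequencies
    (p : ℕ → ℝ) (hp_anti : Antitone p) (hp_sum : HasSum p 1)
    (C₀ : ℝ) (hC₀ : 0 < C₀)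
    (hp : Tendsto (fun l : ℕ => p l / (C₀ * ((l : ℝ) + 1) ^ (-(1 / α)))) atTop (𝓝 1))
    -- the independent Poisson processes of the Poissonized model
    (N : ℕ → ℝ≥0 → Ω → ℕ)
    (hN : ∀ l, KarlinModel.IsPoissonProcess (N l) (p l).toNNReal P)
    (hN_indep : iIndepFun (fun l ω => fun t : ℝ≥0 => N l t ω) P)
    -- the weights
    (a : ℕ → ℝ) (ha₀ : a 0 = 0)
    (β : ℝ) (hβ : β ∈ Set.Ico 0 (α / 2))
    (C : ℝ) (ha : ∀ j : ℕ, 1 ≤ j → |a j| ≤ C * (j : ℝ) ^ β)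
    -- the standard Poisson process and the Gaussian random measure that define the limit
    (N' : ℝ≥0 → Ω' → ℕ) (hN' : KarlinModel.IsPoissonProcess N' 1 P')
    (M : Set (ℝ × Ω') → Ω'' → ℝ)
    (hM : KarlinModel.IsGaussianRandomMeasure M (KarlinModel.intensity α P') P'') :
    -- the series that define the Poissonized process converge and agree
    (∀ (n : ℕ) (t : ℝ≥0), ∀ᵐ ω ∂P,
      Summable (fun j : ℕ => a (j + 1) * (KarlinModel.occupancy N (n * t) (j + 1) ω
        - ∫ ω', KarlinModel.occupancy N (n * t) (j + 1) ω' ∂P)) ∧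
      HasSum (fun l : ℕ => a (N l (n * t) ω) - ∫ ω', a (N l (n * t) ω') ∂P)
        (KarlinModel.poissonizedW a N P n t ω)) ∧
    -- the stochastic integrals that define the limit exist
    (∀ t : ℝ≥0, KarlinModel.IsStochasticIntegral M (KarlinModel.intensity α P') P''
      (KarlinModel.kernelZ a N' P' t) (KarlinModel.limitZ α a N' P' M P'' t)) ∧
    -- convergence of the finite-dimensional distributions on the time interval `[0, 1]`
    KarlinModel.FddTendsto
      (fun (n : ℕ) (t : Set.Icc (0 : ℝ≥0) 1) ω =>
        KarlinModel.poissonizedW a N P n t ω / KarlinModel.sigma p n) P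
      (fun t : Set.Icc (0 : ℝ≥0) 1 => KarlinModel.limitZ α a N' P' M P'' t) P'' := by
  have hpos := KarlinModel.frequency_pos hp_anti hp_sum.summable hp
  have haw := KarlinModel.abs_le_mul_powWeight ha₀ ha
  have hβ1 : 2 * β ≤ 1 := by linarith [hβ.2, hα.2]
  have hseries := fun (n : ℕ) (t : ℝ≥0) => KarlinModel.ae_hasSum_poissonizedW hp_sum.summable
    (fun l => (hpos l).le) hN ha₀ hβ1 haw n t
  have hZ : ∀ t : ℝ≥0, KarlinModel.IsStochasticIntegral M (KarlinModel.intensity α P') P''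
      (KarlinModel.kernelZ a N' P' t) (KarlinModel.limitZ α a N' P' M P'' t) := fun t =>
    KarlinModel.isStochasticIntegral_stochasticIntegral hM (hN'.memLp_kernelZ hα hβ haw t)
  refine ⟨hseries, hZ, fun d t => ?_⟩
  refine KarlinModel.tendstoInDistribution_of_tendsto_integral_exp
    (X := fun n i ω => KarlinModel.poissonizedW a N P n (t i) ω / KarlinModel.sigma p n)
    (Z := fun i => KarlinModel.limitZ α a N' P' M P'' (t i))
    (fun n i => (KarlinModel.aemeasurable_poissonizedW (fun l => (hN l).measurable)
      ((hseries n (t i)).mono fun _ h => h.2)).div_const _)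
    (fun i => (hZ (t i)).memLp.1.aemeasurable) fun θ => ?_
  rw [KarlinModel.integral_exp_sum_of_isStochasticIntegral hM θ fun i => hZ (t i)]
  exact KarlinModel.tendsto_integral_exp_poissonizedW hα hpos hp_sum.summable hC₀ hp hβ haw hN' ha₀
    hN hN_indep θ fun i => t i
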